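/- **Setting.** A hypergraph is a pair $G=(V,E)$ where every $e\in E$ (a hyperedge) is a nonempty subset of $V$; a hitting set of $G$ is a set $H\subseteq V$ with $H\cap e\neq\emptyset$ for all $e\in E$. View $G$ as the structure with universe $V\sqcup E$, a unary relation $E_0=E$, and the binary relation $\epsilon=\{(v,e): v\in V,\ e\in E,\ v\in e\}$. Let $\tau=\{E_0,\epsilon,<,+,\times\}$ with $<$ binary and $+,\times$ ternary. Let $\mathrm{ARITHM}[\tau]$ be the class of finite nonempty $\tau$-structures $A$ whose $\{<,+,\times\}$-reduct is isomorphic to $\{0,\dots,n-1\}$, $n=|A|$, with the natural order and the graphs of addition and multiplication of natural numbers restricted to $\{0,\dots,n-1\}$. For $m\in\mathbb N$ let $A_{C(m)}$ be the expansion of $A$ by constants $\overline 0,\dots,\overline{m-1}$, where $\overline\ell$ denotes the $\ell$-th element of $A$ (counted from $0$) if $\ell<n$ and the last element otherwise. For $d\ge 1$, the parameterized $d$-hitting set problem $p\text{-}d\text{-}\mathrm{HS}$ is the class of all pairs $(A,k)\in\mathrm{ARITHM}[\tau]\times\mathbb N$ such that the $\{E_0,\epsilon\}$-reduct of $A$ is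 isomorphic to a hypergraph (viewed as a structure) all of whose hyperedges have at most $d$ elements and which has a hitting set of size exactly $k$. A parameterized problem $Q\subseteq \mathrm{ARITHM}[\tau]\times\mathbb N$ (with every slice closed under isomorphism) is *slicewise definable in $\mathrm{FO}_q$* if there are a computable $h:\mathbb N\to\mathbb N$ and a computable map assigning to each $k\in\mathbb N$ a first-order sentence $\varphi_k$ of vocabulary $\tau\cup\{\overline 0,\dots,\overline{h(k)-1}\}$ and of quantifier rank at most $q$ such that for all $(A,k)\in\mathrm{ARITHM}[\tau]\times\mathbb N$, $$(A,k)\in Q\iff A_{C(h(k))}\models\varphi_k .$$ **Theorem.** There is a constant $C$ such that for every $d\ge 1$ there is some $q\le C d^2$ for which $p\text{-}d\text{-}\mathrm{HS}$ is slicewise definable in $\mathrm{FO}_q$. -/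

import Mathlib

open FirstOrder FirstOrder.Language

namespace SliceFO

/-! ### Quantifier rank and codes of first-order formulas -/

/-- The quantifier rank. Mathlib's primitive formulas are built from `⊥`, atoms, `→` and `∀`;
`¬`, `∧`, `∨`, `∃` are abbreviations and have the usual ranks, see `qr_not`, `qr_inf`, `qr_sup`,
`qr_ex` below. -/
def qr {L : FirstOrder.Language.{0, 0}} {α : Type} : {n : ℕ} → L.BoundedFormula α n → ℕ
  | _, .falsum => 0
  | _, .equal _ _ => 0
  | _, .rel _ _ => 0
  | _, .imp φ ψ => max (qr φ) (qr ψ)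
  | _, .all φ => 1 + qr φ

section qr

variable {L : FirstOrder.Language.{0, 0}} {α : Type} {n : ℕ}

theorem qr_not (φ : L.BoundedFormula α n) : qr (∼φ) = qr φ := by
  show max (qr φ) 0 = qr φ
  simp

theorem qr_inf (φ ψ : L.BoundedFormula α n) : qr (φ ⊓ ψ) = max (qr φ) (qr ψ) := by
  show max (max (qr φ) (max (qr ψ) 0)) 0 = max (qr φ) (qr ψ)
  simp

theorem qr_sup (φ ψ : L.BoundedFormula α n) : qr (φ ⊔ ψ) = max (qr φ) (qr ψ) := by
  show max (max (qr φ) 0) (qr ψ) = max (qr φ) (qr ψ)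
  simp

theorem qr_ex (φ : L.BoundedFormula α (n + 1)) : qr (∃' φ) = 1 + qr φ := by
  show max (1 + max (qr φ) 0) 0 = 1 + qr φ
  simp

end qr

section code

variable {L : FirstOrder.Language.{0, 0}} {α : Type}

/-- Gödel number of a term (variables and function symbols are numbered by `Encodable`). -/
def termCode [Encodable α] [∀ n, Encodable (L.Functions n)] : L.Term α → ℕ
  | .var x => Nat.pair 0 (Encodable.encode x)
  | .func (l := l) f ts =>
      Nat.pair 1 (Nat.pair l
        (Nat.pair (Encodable.encode f) (Encodable.encode (List.ofFn fun i => termCode (ts i)))))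

/-- Gödel number of a formula; it is injective, see `code_injective`. -/
def code [Encodable α] [∀ n, Encodable (L.Functions n)] [∀ n, Encodable (L.Relations n)] :
    {n : ℕ} → L.BoundedFormula α n → ℕ
  | _, .falsum => Nat.pair 0 0
  | _, .equal t s => Nat.pair 1 (Nat.pair (termCode t) (termCode s))
  | _, .rel (l := l) R ts =>
      Nat.pair 2 (Nat.pair l
        (Nat.pair (Encodable.encode R) (Encodable.encode (List.ofFn fun i => termCode (ts i)))))
  | _, .imp φ ψ => Nat.pair 3 (Nat.pair (code φ) (code ψ))
  | _, .all φ => Nat.pair 4 (code φ)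

theorem termCode_injective [Encodable α] [∀ n, Encodable (L.Functions n)] :
    Function.Injective (termCode : L.Term α → ℕ) := by
  intro t
  induction t with
  | var x =>
    intro s h
    cases s with
    | var y => simpa [termCode, Nat.pair_eq_pair] using h
    | func g us => simp [termCode, Nat.pair_eq_pair] at h
  | @func l f ts ih =>
    intro s h
    cases s with
    | var y => simp [termCode, Nat.pair_eq_pair] at h
    | @func l' g us =>
      simp only [termCode, Nat.pair_eq_pair, true_and] at h
      obtain ⟨rfl, h₁, h₂⟩ := h
      have h₃ := List.ofFn_injective (Encodable.encode_injective h₂)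
      obtain rfl := Encodable.encode_injective h₁
      congr 1
      funext i
      exact ih i (congrFun h₃ i)

theorem code_injective [Encodable α] [∀ n, Encodable (L.Functions n)]
    [∀ n, Encodable (L.Relations n)] {n : ℕ} :
    Function.Injective (code : L.BoundedFormula α n → ℕ) := by
  intro φ
  induction φ with
  | falsum =>
    intro ψ h
    cases ψ <;> simp [code, Nat.pair_eq_pair] at h ⊢
  | equal t s =>
    intro ψ h
    cases ψ with
    | equal t' s' =>
      simp only [code, Nat.pair_eq_pair, true_and] at h
      rw [termCode_injective h.1, termCode_injective h.2]
    | _ => simp [code, Nat.pair_eq_pair] at h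
  | @rel n l R ts =>
    intro ψ h
    cases ψ with
    | @rel _ l' R' ts' =>
      simp only [code, Nat.pair_eq_pair, true_and] at h
      obtain ⟨rfl, h₁, h₂⟩ := h
      have h₃ := List.ofFn_injective (Encodable.encode_injective h₂)
      obtain rfl := Encodable.encode_injective h₁
      congr 1
      funext i
      exact termCode_injective (congrFun h₃ i)
    | _ => simp [code, Nat.pair_eq_pair] at h
  | imp φ₁ φ₂ ih₁ ih₂ =>
    intro ψ h
    cases ψ with
    | imp ψ₁ ψ₂ =>
      simp only [code, Nat.pair_eq_pair, true_and] at h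
      rw [ih₁ h.1, ih₂ h.2]
    | _ => simp [code, Nat.pair_eq_pair] at h
  | all φ ih =>
    intro ψ h
    cases ψ with
    | all ψ =>
      simp only [code, Nat.pair_eq_pair, true_and] at h
      rw [ih h]
    | _ => simp [code, Nat.pair_eq_pair] at h

end code

/-! ### Structures with built-in addition and multiplication -/

/-- The relation symbols `<`, `+`, `×`. -/
inductive ArithRel : ℕ → Type
  | lt : ArithRel 2
  | add : ArithRel 3
  | mul : ArithRel 3

/-- The relational vocabulary `{<, +, ×}`. -/
def arith : FirstOrder.Language.{0, 0} := ⟨fun _ => Empty, ArithRel⟩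

/-- The vocabulary `σ ∪ {<, +, ×}`. -/
abbrev withArith (σ : FirstOrder.Language.{0, 0}) : FirstOrder.Language.{0, 0} := σ.sum arith

/-- The vocabulary `σ ∪ {<, +, ×} ∪ C(m)`, with constants `0, …, m - 1`. -/
abbrev withNumerals (σ : FirstOrder.Language.{0, 0}) (m : ℕ) : FirstOrder.Language.{0, 0} := (withArith σ)[[Fin m]]

/-- The symbol `<` of `σ ∪ {<, +, ×}`. -/
abbrev ltSym (σ : FirstOrder.Language.{0, 0}) : (withArith σ).Relations 2 := Sum.inr ArithRel.lt

/-- The symbol `+` of `σ ∪ {<, +, ×}`. -/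
abbrev addSym (σ : FirstOrder.Language.{0, 0}) : (withArith σ).Relations 3 := Sum.inr ArithRel.add

/-- The symbol `×` of `σ ∪ {<, +, ×}`. -/
abbrev mulSym (σ : FirstOrder.Language.{0, 0}) : (withArith σ).Relations 3 := Sum.inr ArithRel.mul

instance (n : ℕ) : IsEmpty (arith.Functions n) := inferInstanceAs (IsEmpty Empty)

instance (n : ℕ) : Encodable (arith.Relations n) :=
  Encodable.ofLeftInjection (α := ℕ)
    (fun R => match R with
      | ArithRel.lt => 0
      | ArithRel.add => 0
      | ArithRel.mul => 1)
    (fun c => match n, c with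
      | 2, 0 => some ArithRel.lt
      | 3, 0 => some ArithRel.add
      | 3, 1 => some ArithRel.mul
      | _, _ => none)
    (fun R => by cases R <;> rfl)

instance (L L' : FirstOrder.Language.{0, 0}) (n : ℕ) [Encodable (L.Functions n)]
    [Encodable (L'.Functions n)] : Encodable ((L.sum L').Functions n) :=
  inferInstanceAs (Encodable (L.Functions n ⊕ L'.Functions n))

instance (L L' : FirstOrder.Language.{0, 0}) (n : ℕ) [Encodable (L.Relations n)]
    [Encodable (L'.Relations n)] : Encodable ((L.sum L').Relations n) :=
  inferInstanceAs (Encodable (L.Relations n ⊕ L'.Relations n))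

instance (α : Type) [Encodable α] (n : ℕ) : Encodable ((constantsOn α).Functions n) :=
  match n with
  | 0 => inferInstanceAs (Encodable α)
  | _ + 1 => inferInstanceAs (Encodable PEmpty)

instance (α : Type) (n : ℕ) : Encodable ((constantsOn α).Relations n) :=
  inferInstanceAs (Encodable Empty)

instance (σ : FirstOrder.Language.{0, 0}) [σ.IsRelational] (m n : ℕ) :
    Encodable ((withNumerals σ m).Functions n) :=
  haveI : IsEmpty (σ.Functions n) := inferInstance
  haveI : IsEmpty (arith.Functions n) := inferInstance
  inferInstanceAs (Encodable (((withArith σ).sum (constantsOn (Fin m))).Functions n))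

instance (σ : FirstOrder.Language.{0, 0}) [∀ n, Encodable (σ.Relations n)] (m n : ℕ) :
    Encodable ((withNumerals σ m).Relations n) :=
  inferInstanceAs (Encodable (((withArith σ).sum (constantsOn (Fin m))).Relations n))

/-- A finite structure of vocabulary `σ ∪ {<, +, ×}` with built-in addition and multiplication:
its `{<, +, ×}`-reduct is isomorphic, via `pos`, to `{0, …, size - 1}` with the natural order and
the graphs of addition and multiplication. As `pos` is an isomorphism of finite linear orders, it is
determined by the structure, see `ArithStructure.pos_unique`. -/
structure ArithStructure (σ : FirstOrder.Language.{0, 0}) where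
  carrier : Type
  str : (withArith σ).Structure carrier
  size : ℕ
  size_pos : 0 < size
  pos : carrier ≃ Fin size
  lt_iff : ∀ a b : carrier,
    Structure.RelMap (ltSym σ) ![a, b] ↔
      (pos a : ℕ) < pos b
  add_iff : ∀ a b c : carrier,
    Structure.RelMap (addSym σ) ![a, b, c] ↔
      (pos c : ℕ) = pos a + pos b
  mul_iff : ∀ a b c : carrier,
    Structure.RelMap (mulSym σ) ![a, b, c] ↔
      (pos c : ℕ) = pos a * pos b

namespace ArithStructure

variable {σ : FirstOrder.Language.{0, 0}}

instance (A : ArithStructure σ) : (withArith σ).Structure A.carrier := A.str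

/-- The `σ`-reduct. -/
instance (A : ArithStructure σ) : σ.Structure A.carrier :=
  (LHom.sumInl : σ →ᴸ withArith σ).reduct A.carrier

theorem pos_unique (A : ArithStructure σ) (e : A.carrier ≃ Fin A.size)
    (he : ∀ a b : A.carrier,
      Structure.RelMap (ltSym σ) ![a, b] ↔ e a < e b) :
    e = A.pos := by
  have hlt : ∀ x y : Fin A.size, (A.pos.symm.trans e) x < (A.pos.symm.trans e) y ↔ x < y := by
    intro x y
    have h₁ := he (A.pos.symm x) (A.pos.symm y)
    have h₂ := A.lt_iff (A.pos.symm x) (A.pos.symm y)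
    simp only [Equiv.apply_symm_apply] at h₂
    exact h₁.symm.trans h₂
  let g : Fin A.size ≃o Fin A.size :=
    { A.pos.symm.trans e with
      map_rel_iff' := fun {x y} => by
        have := hlt y x
        exact not_lt.symm.trans ((not_congr this).trans not_lt) }
  have hg : g = OrderIso.refl _ := Subsingleton.elim _ _
  ext a
  have := congrArg (fun f : Fin A.size ≃o Fin A.size => ((f (A.pos a) : Fin A.size) : ℕ)) hg
  simpa [g] using this

/-- The interpretation of the constant `ℓ`: the `ℓ`-th element, or the last one if there is no
`ℓ`-th element. -/
def numeral (A : ArithStructure σ) (l : ℕ) : A.carrier :=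
  A.pos.symm ⟨min l (A.size - 1), by have := A.size_pos; omega⟩

/-- The expansion of `A` by the built-in constants `C(m)`. -/
@[reducible] def expansion (A : ArithStructure σ) (m : ℕ) : (withNumerals σ m).Structure A.carrier :=
  letI : (constantsOn (Fin m)).Structure A.carrier :=
    constantsOn.structure fun l => A.numeral l
  inferInstanceAs (((withArith σ).sum (constantsOn (Fin m))).Structure A.carrier)

/-- The expansion of `A` by `C(m)` is a model of the sentence `φ`. -/
def Models (A : ArithStructure σ) {m : ℕ} (φ : (withNumerals σ m).Sentence) : Prop :=
  letI := A.expansion m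
  A.carrier ⊨ φ

end ArithStructure

/-! ### Parameterized problems and slicewise definability -/

/-- A parameterized problem: a class of pairs `(A, k)`, every slice of which is closed under
isomorphism. -/
structure ParamProblem (σ : FirstOrder.Language.{0, 0}) where
  Yes : ArithStructure σ → ℕ → Prop
  iso_closed : ∀ (A B : ArithStructure σ) (k : ℕ),
    Nonempty (A.carrier ≃[withArith σ] B.carrier) → Yes A k → Yes B k

/-- `Q` is slicewise definable in first-order logic of quantifier rank at most `q`. The vocabulary
`σ` is relational and finite. -/
def SlicewiseDefinable {σ : FirstOrder.Language.{0, 0}} [σ.IsRelational] [Finite (Σ n, σ.Relations n)]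
    [∀ n, Encodable (σ.Relations n)] (Q : ParamProblem σ) (q : ℕ) : Prop :=
  ∃ (h : ℕ → ℕ) (f : (k : ℕ) → (withNumerals σ (h k)).Sentence),
    Computable h ∧ Computable (fun k => code (f k)) ∧
    (∀ k, qr (f k) ≤ q) ∧
    ∀ (A : ArithStructure σ) (k : ℕ), Q.Yes A k ↔ A.Models (f k)

/-! ### The hitting set problem -/

/-- The relation symbols `E₀` (being a hyperedge) and `ε` (incidence). -/
inductive HyperRel : ℕ → Type
  | edge : HyperRel 1
  | mem : HyperRel 2

/-- The vocabulary `{E₀, ε}`. -/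
def hyper : FirstOrder.Language.{0, 0} := ⟨fun _ => Empty, HyperRel⟩

instance : hyper.IsRelational := fun _ => inferInstanceAs (IsEmpty Empty)

instance (n : ℕ) : Encodable (hyper.Relations n) :=
  Encodable.ofLeftInjection (α := Unit)
    (fun _ => ())
    (fun _ => match n with
      | 1 => some HyperRel.edge
      | 2 => some HyperRel.mem
      | _ => none)
    (fun R => by cases R <;> rfl)

instance : Finite (Σ n, hyper.Relations n) :=
  Finite.of_surjective
    (fun b : Bool => if b then (⟨1, HyperRel.edge⟩ : Σ n, hyper.Relations n)
      else ⟨2, HyperRel.mem⟩)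
    (by
      rintro ⟨_, R⟩
      cases R
      · exact ⟨true, rfl⟩
      · exact ⟨false, rfl⟩)

/-- A hypergraph `(V, E)` as a structure with universe the disjoint union of `V` and `E`. -/
instance incidenceStructure {α : Type} (G : Hypergraph α) :
    hyper.Structure (G.vertexSet ⊕ G.edgeSet) where
  funMap := fun f => Empty.elim f
  RelMap := fun R x => match R with
    | HyperRel.edge => ∃ e, x 0 = Sum.inr e
    | HyperRel.mem => ∃ v e, x 0 = Sum.inl v ∧ x 1 = Sum.inr e ∧ (v : α) ∈ (e : Set α)

/-- All hyperedges are nonempty and have at most `d` elements. -/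
def IsDHypergraph (d : ℕ) {α : Type} (G : Hypergraph α) : Prop :=
  ∀ e ∈ G.edgeSet, e.Nonempty ∧ e.encard ≤ d

/-- `S` is a set of vertices that intersects each hyperedge. -/
def IsHittingSet {α : Type} (G : Hypergraph α) (S : Set α) : Prop :=
  S ⊆ G.vertexSet ∧ ∀ e ∈ G.edgeSet, (S ∩ e).Nonempty

/-- The parameterized `d`-hitting set problem: `(A, k)` is a yes-instance if the `{E₀, ε}`-reduct
of `A` is (up to isomorphism) a hypergraph with hyperedges of size at most `d` that has a hitting
set of size `k`. -/
def pHittingSet (d : ℕ) : ParamProblem hyper where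
  Yes A k := ∃ (α : Type) (G : Hypergraph α),
    IsDHypergraph d G ∧
    Nonempty (A.carrier ≃[hyper] (G.vertexSet ⊕ G.edgeSet)) ∧
    ∃ S : Set α, IsHittingSet G S ∧ S.encard = k
  iso_closed := by
    rintro A B k ⟨e⟩ ⟨α, G, hd, ⟨g⟩, hS⟩
    let e' : A.carrier ≃[hyper] B.carrier :=
      { e.toEquiv with
        map_fun' := fun f x => e.map_fun (Sum.inl f : (withArith hyper).Functions _) x
        map_rel' := fun R x => e.map_rel (Sum.inl R : (withArith hyper).Relations _) x }
    exact ⟨α, G, hd, ⟨g.comp e'.symm⟩, hS⟩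

end SliceFO

/-! Absence of small hitting sets has a bounded witness. If hyperedges have at most `d` elements and
no set of size at most `k` hits them all, then already some `(d + 1) ^ k` of them cannot be hit:
branch on the elements of one hyperedge (`exists_small_obstruction`). Quantifying over these
hyperedges one by one would make the rank grow with `k`, so the whole obstruction is packed into
three elements `p`, `s`, `t`.

The obstruction is a matrix with `N` rows of `d` vertices, `M = N * d` entries in all. A modulus `p`
of size logarithmic in the universe separates the entries (`exists_separating_modulus`). Their
residues are then so small that Gödel's β-function codes all `M` of them by a pair `s`, `t` inside
the universe, once the universe is large compared with `M` (`exists_hash_code`). Row and entry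
indices are handled by constants and by finite conjunctions and disjunctions, so they cost no
quantifiers.

Decoding needs no injectivity to be sound: if each row contains the residues of all elements of some
hyperedge, and no `k` entries meet every row, then no `k` vertices hit every hyperedge
(`not_hits_of_coded_obstruction`). Injectivity on the listed vertices is what makes genuine
obstructions pass the test (`sat_obstructionF_of_no_hits`).

In a small universe every element is a constant, and a disjunction over all `k`-tuples of constants
decides the problem. In a large one, a hitting set of size at most `k` can be enlarged to size
exactly `k` (`IsIncidence.exists_hits_encard_eq`). The rank depends on `d` only through the sentence
that bounds the sizes of hyperedges; it is at most `d + 10`. -/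

namespace SliceFO

/-! ### Bounded obstructions to small hitting sets -/

/-- A family of finite sets of size at most `d` without a hitting set of size at most `k` contains
a subfamily of at most `(d + 1) ^ k` sets with the same property. -/
theorem exists_small_obstruction {V : Type*} [DecidableEq V] (d k : ℕ) (F : Finset (Finset V))
    (hF : ∀ e ∈ F, e.card ≤ d)
    (hno : ∀ H : Finset V, H.card ≤ k → ∃ e ∈ F, Disjoint H e) :
    ∃ G ⊆ F, G.card ≤ (d + 1) ^ k ∧
      ∀ H : Finset V, H.card ≤ k → ∃ e ∈ G, Disjoint H e := by
  induction k generalizing F with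
  | zero =>
    obtain ⟨e, he, -⟩ := hno ∅ (by simp)
    refine ⟨{e}, by simpa using he, by simp, fun H hH => ⟨e, by simp, ?_⟩⟩
    obtain rfl : H = ∅ := by simpa using hH
    simp
  | succ k ih =>
    obtain ⟨e, he, -⟩ := hno ∅ (by simp)
    -- If `k` elements hit all sets avoiding `v`, adding `v` would give a hitting set of size `k +
    -- 1`. So the induction hypothesis applies to these sets; below, `v` runs through the single set
    -- `e`, which gives at most `1 + d * (d + 1) ^ k` sets.
    have hsub : ∀ v : V, ∃ G ⊆ F.filter (fun f => v ∉ f), G.card ≤ (d + 1) ^ k ∧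
        ∀ H : Finset V, H.card ≤ k → ∃ f ∈ G, Disjoint H f := by
      intro v
      refine ih _ (fun f hf => hF f (Finset.mem_filter.1 hf).1) fun H hH => ?_
      obtain ⟨f, hf, hd⟩ := hno (insert v H) ((Finset.card_insert_le _ _).trans (by omega))
      rw [Finset.disjoint_insert_left] at hd
      exact ⟨f, Finset.mem_filter.2 ⟨hf, hd.1⟩, hd.2⟩
    choose G hGF hGc hG using hsub
    refine ⟨insert e (e.biUnion G), ?_, ?_, fun H hH => ?_⟩
    · intro f hf
      simp only [Finset.mem_insert, Finset.mem_biUnion] at hf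
      rcases hf with rfl | ⟨v, -, hf⟩
      · exact he
      · exact (Finset.mem_filter.1 (hGF v hf)).1
    · have h₁ : (e.biUnion G).card ≤ d * (d + 1) ^ k :=
        (Finset.card_biUnion_le_card_mul _ _ _ fun v _ => hGc v).trans
          (Nat.mul_le_mul_right _ (hF e he))
      have h₂ : 1 ≤ (d + 1) ^ k := Nat.one_le_pow _ _ (by omega)
      refine (Finset.card_insert_le _ _).trans ?_
      rw [pow_succ]
      nlinarith
    · by_cases hd : Disjoint H e
      · exact ⟨e, by simp, hd⟩
      · obtain ⟨v, hvH, hve⟩ := Finset.not_disjoint_iff.1 hd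
        obtain ⟨f, hf, hdf⟩ := hG v (H.erase v) (by
          rw [Finset.card_erase_of_mem hvH]; omega)
        refine ⟨f, Finset.mem_insert_of_mem (Finset.mem_biUnion.2 ⟨v, hve, hf⟩), ?_⟩
        have hvf : v ∉ f := (Finset.mem_filter.1 (hGF v hf)).2
        rw [Finset.disjoint_left] at hdf ⊢
        intro a haH haf
        exact hdf (Finset.mem_erase.2 ⟨fun h => hvf (h ▸ haf), haH⟩) haf

/-! ### Coding sequences by small numbers -/

theorem two_pow_le_centralBinom (m : ℕ) : 2 ^ m ≤ m.centralBinom := by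
  induction m with
  | zero => simp
  | succ m ih =>
    have h := Nat.succ_mul_centralBinom_succ m
    have : (m + 1) * (2 * m.centralBinom) ≤ (m + 1) * (m + 1).centralBinom := by
      rw [h]; nlinarith [m.centralBinom_pos]
    rw [pow_succ]
    have := Nat.le_of_mul_le_mul_left this (by omega)
    omega

/-- Every prime power dividing the central binomial coefficient of `m` is at most `2 * m`. A number
divisible by all of `1, …, 2 * m` is therefore divisible by this coefficient, which is at least `2 ^
m`. -/
theorem exists_not_dvd_of_lt_two_pow {D m : ℕ} (hD : D ≠ 0) (h : D < 2 ^ m) :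
    ∃ p, 1 ≤ p ∧ p ≤ 2 * m ∧ ¬ p ∣ D := by
  by_contra! hcon
  have hdvd : m.centralBinom ∣ D := by
    rw [Nat.dvd_iff_prime_pow_dvd_dvd]
    intro q e hq hqe
    have hm : 0 < 2 * m := by
      rcases Nat.eq_zero_or_pos m with rfl | hm
      · simp at h; omega
      · omega
    have he : e ≤ m.centralBinom.factorization q :=
      (hq.pow_dvd_iff_le_factorization m.centralBinom_ne_zero).1 hqe
    refine hcon _ (Nat.one_le_pow _ _ hq.pos) ?_
    refine (Nat.pow_le_pow_right hq.pos he).trans ?_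
    exact Nat.pow_factorization_choose_le hm
  have := Nat.le_of_dvd (Nat.pos_of_ne_zero hD) hdvd
  have := two_pow_le_centralBinom m
  omega

/-- Finitely many numbers are kept apart by their residues modulo a number of polylogarithmic
size. -/
theorem exists_separating_modulus {M n L : ℕ} (hM : 0 < M) (v : Fin M → ℕ)
    (hv : ∀ i, v i < n)    (hn : n ≤ 2 ^ L) :
    ∃ p, 1 ≤ p ∧ p ≤ 2 * ((L + 1) * M ^ 2) ∧ ∀ i j, v i ≠ v j → v i % p ≠ v j % p := by
  -- Vanishing differences are replaced by `1`, so the product is nonzero. A `p` not dividing the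
  -- product divides none of the nonzero differences.
  set f : Fin M × Fin M → ℕ := fun x => if v x.1 = v x.2 then 1 else Nat.dist (v x.1) (v x.2)
    with hf
  have hf0 : ∀ x, f x ≠ 0 := by
    intro x
    simp only [hf]
    split_ifs with h
    · simp
    · exact fun h0 => h (Nat.eq_of_dist_eq_zero h0)
  have hle : ∀ x, f x ≤ 2 ^ L := by
    intro x
    have h₁ := hv x.1
    have h₂ := hv x.2
    simp only [hf, Nat.dist]
    split_ifs with h
    · exact Nat.one_le_two_pow
    · omega
  have hprod : ∏ x, f x ≤ (2 ^ L) ^ (M ^ 2) := by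
    refine (Finset.prod_le_pow_card _ _ _ fun x _ => hle x).trans ?_
    simp [sq]
  obtain ⟨p, hp1, hp2, hp3⟩ := exists_not_dvd_of_lt_two_pow (D := ∏ x, f x)
    (m := (L + 1) * M ^ 2) (Finset.prod_ne_zero_iff.2 fun x _ => hf0 x)
    (hprod.trans_lt (by
      rw [← pow_mul]
      exact Nat.pow_lt_pow_right (by norm_num) (Nat.mul_lt_mul_of_pos_right (by omega)
        (by positivity))))
  refine ⟨p, hp1, hp2, fun i j hij hmod => hp3 ?_⟩
  refine dvd_trans ?_ (Finset.dvd_prod_of_mem f (Finset.mem_univ (i, j)))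
  simp only [hf, if_neg hij, Nat.dist]
  have h₁ := (Nat.modEq_iff_dvd' (n := p) (a := v i) (b := v j))
  have h₂ := (Nat.modEq_iff_dvd' (n := p) (a := v j) (b := v i))
  rcases le_total (v i) (v j) with h | h
  · rw [Nat.sub_eq_zero_of_le h, zero_add]; exact (h₁ h).1 hmod
  · rw [Nat.sub_eq_zero_of_le h, add_zero]; exact (h₂ h).1 hmod.symm

/-- Gödel's `β`-function with an explicit bound on the code. -/
theorem exists_beta_code {M t : ℕ} (ht : M.factorial ∣ t) (z : Fin M → ℕ) (hz : ∀ i, z i ≤ t) :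
    ∃ s, s < (M * t + 2) ^ M ∧ ∀ i : Fin M, s % ((i + 1) * t + 1) = z i := by
  have hco : ∀ i j : Fin M, i < j →
      Nat.Coprime ((i + 1) * t + 1) ((j + 1) * t + 1) := by
    intro i j hij
    -- Coprimality follows once the difference of the indices divides `t`; that difference is
    -- positive and at most `M`, so it divides `M.factorial`.
    refine Nat.coprime_mul_succ ?_
    refine (Nat.dvd_factorial ?_ ?_).trans ht
    · have : (i : ℕ) < j := hij
      omega
    · have := j.isLt
      omega
  have hpw : Set.Pairwise (↑(Finset.univ : Finset (Fin M)))
      (Function.onFun Nat.Coprime fun i : Fin M => (i + 1) * t + 1) := by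
    intro i _ j _ hij
    rcases lt_or_gt_of_ne hij with h | h
    · exact hco i j h
    · exact (hco j i h).symm
  let s := Nat.chineseRemainderOfFinset z (fun i : Fin M => (i + 1) * t + 1) Finset.univ
    (fun _ _ => by positivity) hpw
  refine ⟨s, ?_, fun i => ?_⟩
  · refine (Nat.chineseRemainderOfFinset_lt_prod z _ (fun _ _ => by positivity) hpw).trans_le ?_
    refine (Finset.prod_le_pow_card _ _ (M * t + 2) fun i _ => ?_).trans (by simp)
    have : (i + 1) * t ≤ M * t := Nat.mul_le_mul_right _ i.isLt
    omega
  · have h := s.2 i (Finset.mem_univ i)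
    have hlt : z i < (i + 1) * t + 1 := by
      have := hz i
      nlinarith [Nat.zero_le ((i : ℕ) * t)]
    exact Eq.trans h (Nat.mod_eq_of_lt hlt)

/-- A fixed power of a logarithm is eventually below the number itself. With `x = L / (2 * M)`, the
base is at most `(x + 1) ^ 2 ≤ 2 ^ (2 * x)`, and `2 * M * x ≤ L`. -/
theorem linear_pow_le_two_pow {M c L : ℕ} (hM : 0 < M) (hL : 4 * M ^ 2 * c ≤ L) :
    (c * (L + 1)) ^ M ≤ 2 ^ L := by
  set x := L / (2 * M) with hx
  have h₁ : 2 * M * x ≤ L := Nat.mul_div_le _ _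
  have h₂ : L < 2 * M * (x + 1) := Nat.lt_mul_div_succ L (by omega)
  have h₃ : 2 * M * c ≤ x := by
    rw [hx, Nat.le_div_iff_mul_le (by omega)]
    nlinarith
  have h₄ : c * (L + 1) ≤ (2 ^ x) ^ 2 := by
    have h₅ : x + 1 ≤ 2 ^ x := Nat.lt_two_pow_self
    calc c * (L + 1) ≤ c * (2 * M * (x + 1)) := Nat.mul_le_mul_left _ h₂
      _ = (2 * M * c) * (x + 1) := by ring
      _ ≤ (x + 1) * (x + 1) := Nat.mul_le_mul_right _ (by omega)
      _ ≤ (2 ^ x) ^ 2 := by rw [sq]; exact Nat.mul_le_mul h₅ h₅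
  calc (c * (L + 1)) ^ M ≤ ((2 ^ x) ^ 2) ^ M := Nat.pow_le_pow_left h₄ _
    _ = 2 ^ (2 * M * x) := by rw [← pow_mul, ← pow_mul]; ring_nf
    _ ≤ 2 ^ L := Nat.pow_le_pow_right (by norm_num) h₁

/-- A size from which on sequences of length `M` can be coded, after hashing, by elements. -/
def codingBound (M : ℕ) : ℕ := 2 ^ (4 * M ^ 2 * (4 * M ^ 3 * M ^ M))

/-- With `L` the binary logarithm of `n`, both `p` and `t` are linear in `L` for fixed `M`, so the
bound `(M * t + 2) ^ M` on the β-code is polylogarithmic and fits below `n`. -/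
theorem exists_hash_code {M n : ℕ} (hM : 2 ≤ M) (hn : codingBound M ≤ n) (v : Fin M → ℕ)
    (hv : ∀ i, v i < n) :
    ∃ p s t, 0 < p ∧ p < n ∧ s < n ∧ t < n ∧ M * t + 1 < n ∧
      (∀ i : Fin M, s % ((i + 1) * t + 1) = v i % p) ∧
      ∀ i j, v i ≠ v j → v i % p ≠ v j % p := by
  set L := Nat.log 2 n with hL
  set c := 4 * M ^ 3 * M ^ M with hc
  have hn0 : n ≠ 0 := by
    have : 0 < codingBound M := by unfold codingBound; positivity
    omega
  have hLc : 4 * M ^ 2 * c ≤ L := Nat.le_log_of_pow_le (by norm_num) hn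
  have hLn : 2 ^ L ≤ n := Nat.pow_log_le_self 2 hn0
  obtain ⟨p, hp1, hp2, hp3⟩ := exists_separating_modulus (L := L + 1) (by omega : 0 < M) v hv
    (Nat.lt_pow_succ_log_self (by norm_num) n).le
  -- A multiple of `M.factorial`, for coprime moduli, that is also at least `p`, so that residues
  -- modulo `p` are admissible entries.
  set t := M.factorial * (2 * ((L + 1 + 1) * M ^ 2)) with ht
  have hfac : 1 ≤ M.factorial := M.factorial_pos
  have hpt : p ≤ t := hp2.trans (Nat.le_mul_of_pos_left _ hfac)
  obtain ⟨s, hs, hsz⟩ := exists_beta_code (M := M) (t := t) (Dvd.intro _ rfl)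
    (fun i => v i % p) (fun i => ((Nat.mod_lt _ hp1).le.trans hpt))
  -- The constant in `codingBound` comes from here, via `M.factorial ≤ M ^ M`; `1 ≤ L` absorbs the
  -- additive terms.
  have hbig : M * t + 2 ≤ c * (L + 1) := by
    have hMM : 1 ≤ M ^ 3 * M ^ M := Nat.one_le_iff_ne_zero.2 (by positivity)
    have hL1 : 1 ≤ L := by
      refine le_trans (Nat.one_le_iff_ne_zero.2 ?_) hLc
      rw [hc]; positivity
    have hf : M ^ 3 * M.factorial ≤ M ^ 3 * M ^ M :=
      Nat.mul_le_mul_left _ M.factorial_le_pow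
    calc M * t + 2 = M ^ 3 * M.factorial * (2 * (L + 2)) + 2 := by rw [ht]; ring
      _ ≤ M ^ 3 * M ^ M * (2 * (L + 2)) + 2 := by gcongr
      _ ≤ c * (L + 1) := by rw [hc]; nlinarith
  have hpow := linear_pow_le_two_pow (M := M) (by omega) hLc
  have hMt : M * t + 2 ≤ n := by
    refine hbig.trans (le_trans ?_ (hpow.trans hLn))
    exact Nat.le_self_pow (by omega) _
  have htM : t ≤ M * t := Nat.le_mul_of_pos_left _ (by omega)
  refine ⟨p, s, t, hp1, by omega, ?_, by omega, by omega, hsz, hp3⟩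
  exact hs.trans_le ((Nat.pow_le_pow_left hbig _).trans (hpow.trans hLn))

/-! ### The hitting set problem in terms of the relations `E₀` and `ε` -/

namespace ArithStructure

/-- The relation `E₀`. -/
def IsEdge (A : ArithStructure hyper) (x : A.carrier) : Prop :=
  Structure.RelMap (L := withArith hyper) (Sum.inl HyperRel.edge) ![x]

/-- The relation `ε`. -/
def Inc (A : ArithStructure hyper) (x y : A.carrier) : Prop :=
  Structure.RelMap (L := withArith hyper) (Sum.inl HyperRel.mem) ![x, y]

end ArithStructure

/-- The properties that characterize the incidence structures of hypergraphs with hyperedges of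
size at most `d`, all nonempty. -/
structure IsIncidence (d : ℕ) {A : Type} (E : A → Prop) (I : A → A → Prop) : Prop where
  inc : ∀ v e, I v e → ¬ E v ∧ E e
  nonempty : ∀ e, E e → ∃ v, I v e
  ext : ∀ e f, E e → E f → (∀ v, I v e ↔ I v f) → e = f
  bounded : ∀ e (x : Fin (d + 1) → A), (∀ i, I (x i) e) → ∃ i j, j < i ∧ x i = x j

/-- `S` is a hitting set, for a hypergraph given by its incidence structure. -/
def Hits {A : Type} (E : A → Prop) (I : A → A → Prop) (S : Set A) : Prop :=
  (∀ v ∈ S, ¬ E v) ∧ ∀ e, E e → ∃ v ∈ S, I v e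

theorem IsIncidence.encard_le {d : ℕ} {A : Type} {E : A → Prop} {I : A → A → Prop}
    (h : IsIncidence d E I) (e : A) : {v | I v e}.encard ≤ d := by
  by_contra! hlt
  have hle : ((d + 1 : ℕ) : ℕ∞) ≤ {v | I v e}.encard := by
    push_cast
    exact Order.add_one_le_of_lt hlt
  obtain ⟨t, hte, htc⟩ := Set.exists_subset_encard_eq hle
  have hfin : t.Finite := Set.finite_of_encard_eq_coe htc
  rw [hfin.encard_eq_coe_toFinset_card] at htc
  have hcard : hfin.toFinset.card = d + 1 := by exact_mod_cast htc
  obtain ⟨i, j, hij, hx⟩ := h.bounded e (fun i => (hfin.toFinset.equivFinOfCardEq hcard).symm i)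
    (fun i => hte (hfin.mem_toFinset.1 ((hfin.toFinset.equivFinOfCardEq hcard).symm i).2))
  exact hij.ne' (by simpa using Subtype.ext hx)

theorem isIncidence_of_encard_le {d : ℕ} {A : Type} {E : A → Prop} {I : A → A → Prop}
    (hinc : ∀ v e, I v e → ¬ E v ∧ E e) (hne : ∀ e, E e → ∃ v, I v e)
    (hext : ∀ e f, E e → E f → (∀ v, I v e ↔ I v f) → e = f)
    (hd : ∀ e, {v | I v e}.encard ≤ d) : IsIncidence d E I := by
  refine ⟨hinc, hne, hext, fun e x hx => ?_⟩
  by_contra! hcon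
  have hinj : Function.Injective x := by
    intro i j hij
    rcases lt_trichotomy i j with h | h | h
    · exact absurd hij.symm (hcon j i h)
    · exact h
    · exact absurd hij (hcon i j h)
  have h₁ : (Set.range x).encard ≤ d :=
    (Set.encard_le_encard (by rintro _ ⟨i, rfl⟩; exact hx i)).trans (hd e)
  rw [← Set.image_univ, hinj.encard_image, Set.encard_univ] at h₁
  simp only [ENat.card_eq_coe_fintype_card, Fintype.card_fin] at h₁
  have : d + 1 ≤ d := by exact_mod_cast h₁
  omega

/-- The hypergraph described by an incidence structure. -/
def IsIncidence.toHypergraph {d : ℕ} {A : Type} {E : A → Prop} {I : A → A → Prop}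
    (h : IsIncidence d E I) : Hypergraph A where
  vertexSet := {v | ¬ E v}
  edgeSet := {s | ∃ e, E e ∧ s = {v | I v e}}
  subset_vertexSet_of_mem_edgeSet' := by
    rintro _ ⟨e, -, rfl⟩ v hv
    exact (h.inc v e hv).1

/-- Removes the quantifier over hypergraphs, leaving conditions on `E₀` and `ε` alone. Conversely,
the non-edges serve as vertices and the neighbourhoods `{v | A.Inc v e}` as hyperedges;
extensionality makes `e` recoverable from its neighbourhood. -/
theorem pHittingSet_yes_iff (d k : ℕ) (A : ArithStructure hyper) :
    (pHittingSet d).Yes A k ↔ IsIncidence d A.IsEdge A.Inc ∧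
      ∃ S : Set A.carrier, Hits A.IsEdge A.Inc S ∧ S.encard = k := by
  constructor
  · rintro ⟨α, G, hd, ⟨g⟩, S, ⟨hSV, hS⟩, hk⟩
    have hE : ∀ x, A.IsEdge x ↔ ∃ e, g x = Sum.inr e := by
      intro x
      exact (g.map_rel (HyperRel.edge : hyper.Relations 1) ![x]).symm
    have hI : ∀ x y, A.Inc x y ↔
        ∃ v e, g x = Sum.inl v ∧ g y = Sum.inr e ∧ (v : α) ∈ (e : Set α) := by
      intro x y
      exact (g.map_rel (HyperRel.mem : hyper.Relations 2) ![x, y]).symm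
    have hImem : ∀ y e, g y = Sum.inr e → ∀ v : G.vertexSet,
        A.Inc (g.symm (Sum.inl v)) y ↔ (v : α) ∈ (e : Set α) := by
      intro y e hy v
      rw [hI]
      simp [hy]
    refine ⟨isIncidence_of_encard_le ?_ ?_ ?_ ?_, ?_⟩
    · intro v e h
      obtain ⟨v', e', h₁, h₂, -⟩ := (hI _ _).1 h
      rw [hE, hE]
      exact ⟨by simp [h₁], e', h₂⟩
    · intro y hy
      obtain ⟨e, he⟩ := (hE y).1 hy
      obtain ⟨v, hv⟩ := (hd e e.2).1
      exact ⟨_, (hImem y e he ⟨v, G.subset_vertexSet_of_mem_edgeSet' e.2 hv⟩).2 hv⟩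
    · intro y z hy hz h
      obtain ⟨e, he⟩ := (hE y).1 hy
      obtain ⟨f, hf⟩ := (hE z).1 hz
      have hef : e = f := by
        apply Subtype.ext
        ext v
        constructor
        · intro hv
          have hV := G.subset_vertexSet_of_mem_edgeSet' e.2 hv
          exact (hImem z f hf ⟨v, hV⟩).1 ((h _).1 ((hImem y e he ⟨v, hV⟩).2 hv))
        · intro hv
          have hV := G.subset_vertexSet_of_mem_edgeSet' f.2 hv
          exact (hImem y e he ⟨v, hV⟩).1 ((h _).2 ((hImem z f hf ⟨v, hV⟩).2 hv))
      exact g.injective (by rw [he, hf, hef])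
    · intro y
      by_cases hy : A.IsEdge y
      · obtain ⟨e, he⟩ := (hE y).1 hy
        refine le_trans ?_ (hd e e.2).2
        have hsub : {v | A.Inc v y} ⊆
            (fun v => g.symm (Sum.inl v)) '' {v : G.vertexSet | (v : α) ∈ (e : Set α)} := by
          intro x hx
          obtain ⟨v, e', h₁, h₂, h₃⟩ := (hI _ _).1 hx
          have : e = e' := by rw [he] at h₂; exact Sum.inr.inj h₂
          refine ⟨v, this ▸ h₃, ?_⟩
          simp [← h₁]
        refine (Set.encard_le_encard hsub).trans ((Set.encard_image_le _ _).trans ?_)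
        rw [← Subtype.val_injective.encard_image]
        refine Set.encard_le_encard ?_
        rintro _ ⟨v, hv, rfl⟩
        exact hv
      · have : {v | A.Inc v y} = ∅ := by
          ext x
          simp only [Set.mem_ofPred_eq, Set.mem_empty_iff_false, iff_false, hI]
          rintro ⟨v, e, -, h, -⟩
          exact hy ((hE y).2 ⟨e, h⟩)
        simp [this]
    · have hinj : Function.Injective (fun v : G.vertexSet => g.symm (Sum.inl v)) := fun v w h =>
        Sum.inl.inj (g.symm.injective h)
      refine ⟨(fun v : G.vertexSet => g.symm (Sum.inl v)) '' {v | (v : α) ∈ S}, ⟨?_, ?_⟩, ?_⟩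
      · rintro _ ⟨v, -, rfl⟩
        simp [hE]
      · intro y hy
        obtain ⟨e, he⟩ := (hE y).1 hy
        obtain ⟨v, hv, hve⟩ := hS e e.2
        exact ⟨_, ⟨⟨v, hSV hv⟩, hv, rfl⟩, (hImem y e he ⟨v, hSV hv⟩).2 hve⟩
      · rw [hinj.encard_image, ← Subtype.val_injective.encard_image, ← hk]
        congr 1
        ext v
        simp only [Set.mem_image, Set.mem_ofPred_eq, Subtype.exists, exists_and_left,
          exists_prop, exists_eq_right_right, and_iff_left_iff_imp]
        exact fun h => hSV h
  · rintro ⟨hA, S, ⟨hSV, hS⟩, hk⟩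
    classical
    let G := hA.toHypergraph
    let F : A.carrier → G.vertexSet ⊕ G.edgeSet := fun x =>
      if h : A.IsEdge x then Sum.inr ⟨{v | A.Inc v x}, x, h, rfl⟩ else Sum.inl ⟨x, h⟩
    have hFe : ∀ x (h : A.IsEdge x), F x = Sum.inr ⟨{v | A.Inc v x}, x, h, rfl⟩ := fun x h =>
      dif_pos h
    have hFv : ∀ x (h : ¬ A.IsEdge x), F x = Sum.inl ⟨x, h⟩ := fun x h => dif_neg h
    have hF : Function.Bijective F := by
      constructor
      · intro x y hxy
        by_cases hx : A.IsEdge x <;> by_cases hy : A.IsEdge y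
        · rw [hFe x hx, hFe y hy] at hxy
          have := congrArg Subtype.val (Sum.inr.inj hxy)
          exact hA.ext x y hx hy fun v => Set.ext_iff.1 this v
        · rw [hFe x hx, hFv y hy] at hxy; cases hxy
        · rw [hFv x hx, hFe y hy] at hxy; cases hxy
        · rw [hFv x hx, hFv y hy] at hxy
          exact congrArg Subtype.val (Sum.inl.inj hxy)
      · rintro (⟨v, hv⟩ | ⟨_, e, he, rfl⟩)
        · exact ⟨v, hFv v hv⟩
        · exact ⟨e, hFe e he⟩
    refine ⟨A.carrier, hA.toHypergraph, ?_, ⟨⟨Equiv.ofBijective F hF, ?_, ?_⟩⟩, S,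
      ⟨fun v hv => hSV v hv, ?_⟩, hk⟩
    · rintro _ ⟨e, he, rfl⟩
      exact ⟨hA.nonempty e he, hA.encard_le e⟩
    · intro n f
      exact Empty.elim f
    · intro n R x
      cases R with
      | edge =>
        have hx : x = ![x 0] := by ext i; fin_cases i; rfl
        have h₁ : Structure.RelMap (L := hyper) HyperRel.edge x ↔ A.IsEdge (x 0) := by
          conv_lhs => rw [hx]
          rfl
        refine Iff.trans ?_ h₁.symm
        change (∃ e, F (x 0) = Sum.inr e) ↔ _
        constructor
        · rintro ⟨e, he⟩
          by_contra h
          rw [hFv _ h] at he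
          cases he
        · exact fun h => ⟨_, hFe _ h⟩
      | mem =>
        have hx : x = ![x 0, x 1] := by ext i; fin_cases i <;> rfl
        have h₁ : Structure.RelMap (L := hyper) HyperRel.mem x ↔ A.Inc (x 0) (x 1) := by
          conv_lhs => rw [hx]
          rfl
        refine Iff.trans ?_ h₁.symm
        change (∃ v e, F (x 0) = Sum.inl v ∧ F (x 1) = Sum.inr e ∧
          (v : A.carrier) ∈ (e : Set A.carrier)) ↔ _
        constructor
        · rintro ⟨v, e, h₂, h₃, h₄⟩
          by_cases h0 : A.IsEdge (x 0)
          · rw [hFe _ h0] at h₂; cases h₂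
          by_cases h1 : A.IsEdge (x 1)
          · rw [hFv _ h0] at h₂
            rw [hFe _ h1] at h₃
            cases h₂
            cases h₃
            exact h₄
          · rw [hFv _ h1] at h₃; cases h₃
        · intro h
          obtain ⟨h0, h1⟩ := hA.inc _ _ h
          exact ⟨_, _, hFv _ h0, hFe _ h1, h⟩
    · rintro _ ⟨e, he, rfl⟩
      obtain ⟨v, hv, hve⟩ := hS e he
      exact ⟨v, hv, hve⟩

/-! ### Formulas and their semantics -/

section bigops

variable {L : FirstOrder.Language.{0, 0}} {α : Type} {n : ℕ}

/-- The disjunction of `φ 0, …, φ (N - 1)`. -/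
def bigOr (φ : ℕ → L.BoundedFormula α n) : ℕ → L.BoundedFormula α n
  | 0 => ⊥
  | N + 1 => bigOr φ N ⊔ φ N

/-- The conjunction of `φ 0, …, φ (N - 1)`. -/
def bigAnd (φ : ℕ → L.BoundedFormula α n) : ℕ → L.BoundedFormula α n
  | 0 => ⊤
  | N + 1 => bigAnd φ N ⊓ φ N

theorem qr_bigOr_le {φ : ℕ → L.BoundedFormula α n} {q : ℕ} (N : ℕ) (h : ∀ i, qr (φ i) ≤ q) :
    qr (bigOr φ N) ≤ q := by
  induction N with
  | zero => exact Nat.zero_le _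
  | succ N ih => rw [bigOr, qr_sup]; exact max_le ih (h N)

theorem qr_bigAnd_le {φ : ℕ → L.BoundedFormula α n} {q : ℕ} (N : ℕ) (h : ∀ i, qr (φ i) ≤ q) :
    qr (bigAnd φ N) ≤ q := by
  induction N with
  | zero => exact Nat.zero_le _
  | succ N ih => rw [bigAnd, qr_inf]; exact max_le ih (h N)

theorem qr_alls (φ : L.BoundedFormula α n) : qr φ.alls = n + qr φ := by
  induction n with
  | zero => simp [BoundedFormula.alls]
  | succ n ih =>
    rw [BoundedFormula.alls, ih]
    show n + (1 + qr φ) = n + 1 + qr φ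
    ring

theorem realize_bigOr {M : Type} [L.Structure M] (φ : ℕ → L.BoundedFormula α n) (N : ℕ)
    (v : α → M) (xs : Fin n → M) :
    (bigOr φ N).Realize v xs ↔ ∃ i < N, (φ i).Realize v xs := by
  induction N with
  | zero => simp [bigOr]
  | succ N ih =>
    rw [bigOr, BoundedFormula.realize_sup, ih]
    constructor
    · rintro (⟨i, hi, h⟩ | h)
      · exact ⟨i, by omega, h⟩
      · exact ⟨N, by omega, h⟩
    · rintro ⟨i, hi, h⟩
      rcases Nat.lt_succ_iff_lt_or_eq.1 hi with hi | rfl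
      · exact Or.inl ⟨i, hi, h⟩
      · exact Or.inr h

theorem realize_bigAnd {M : Type} [L.Structure M] (φ : ℕ → L.BoundedFormula α n) (N : ℕ)
    (v : α → M) (xs : Fin n → M) :
    (bigAnd φ N).Realize v xs ↔ ∀ i < N, (φ i).Realize v xs := by
  induction N with
  | zero => simp [bigAnd]
  | succ N ih =>
    rw [bigAnd, BoundedFormula.realize_inf, ih]
    constructor
    · rintro ⟨h₁, h₂⟩ i hi
      rcases Nat.lt_succ_iff_lt_or_eq.1 hi with hi | rfl
      · exact h₁ i hi
      · exact h₂
    · exact fun h => ⟨fun i hi => h i (by omega), h N (by omega)⟩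

end bigops

/-- Formulas with the constants `0, …, m` and free variables `0, …, n - 1`. -/
abbrev Fml (m n : ℕ) : Type := (withNumerals hyper (m + 1)).BoundedFormula Empty n

/-- Terms with the constants `0, …, m` and free variables `0, …, n - 1`. -/
abbrev Tm (m n : ℕ) : Type := (withNumerals hyper (m + 1)).Term (Empty ⊕ Fin n)

section formulas

variable {m n : ℕ}

/-- The `i`-th variable. -/
abbrev vr (i : Fin n) : Tm m n := Term.var (Sum.inr i)

/-- The constant `min i m`. -/
def num (i : ℕ) : Tm m n :=
  Term.func (l := 0) (Sum.inr (⟨min i m, by omega⟩ : Fin (m + 1))) Fin.elim0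

def edgeF (a : Tm m n) : Fml m n :=
  BoundedFormula.rel (Sum.inl (Sum.inl HyperRel.edge)) ![a]

def incF (a b : Tm m n) : Fml m n :=
  BoundedFormula.rel (Sum.inl (Sum.inl HyperRel.mem)) ![a, b]

def ltF (a b : Tm m n) : Fml m n :=
  BoundedFormula.rel (Sum.inl (Sum.inr ArithRel.lt)) ![a, b]

/-- `c = a + b`. -/
def addF (a b c : Tm m n) : Fml m n :=
  BoundedFormula.rel (Sum.inl (Sum.inr ArithRel.add)) ![a, b, c]

/-- `c = a * b`. -/
def mulF (a b c : Tm m n) : Fml m n :=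
  BoundedFormula.rel (Sum.inl (Sum.inr ArithRel.mul)) ![a, b, c]

def eqF (a b : Tm m n) : Fml m n := BoundedFormula.equal a b

/-- `y` is the residue of `x` modulo `p`. -/
def modF (x p y : Fin n) : Fml m n :=
  ltF (vr y) (vr p) ⊓ ∃' ∃' (mulF (vr (Fin.last n).castSucc) (vr p.castSucc.castSucc)
      (vr (Fin.last (n + 1))) ⊓
    addF (vr (Fin.last (n + 1))) (vr y.castSucc.castSucc) (vr x.castSucc.castSucc))

/-- `y` is the residue of `s` modulo `(i + 1) * t + 1`. -/
def betaF (i : ℕ) (s t y : Fin n) : Fml m n :=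
  ∃' ∃' (mulF (num (i + 1)) (vr t.castSucc.castSucc) (vr (Fin.last n).castSucc) ⊓
    addF (vr (Fin.last n).castSucc) (num 1) (vr (Fin.last (n + 1))) ⊓
    modF s.castSucc.castSucc (Fin.last (n + 1)) y.castSucc.castSucc)

end formulas

section semantics

variable {m n : ℕ} (A : ArithStructure hyper)

/-- Satisfaction in the expansion of `A` by constants. -/
def Sat (φ : Fml m n) (xs : Fin n → A.carrier) : Prop :=
  letI := A.expansion (m + 1)
  φ.Realize default xs

/-- The value of a term in the expansion of `A` by constants. -/
def val (t : Tm m n) (xs : Fin n → A.carrier) : A.carrier :=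
  letI := A.expansion (m + 1)
  t.realize (Sum.elim default xs)

theorem models_iff_sat (φ : Fml m 0) : A.Models φ ↔ Sat A φ ![] := by
  let := A.expansion (m + 1)
  unfold ArithStructure.Models Sat Sentence.Realize Formula.Realize
  exact iff_of_eq (congrArg _ (Subsingleton.elim _ _))

variable {A} {xs : Fin n → A.carrier}

@[simp] theorem val_vr (i : Fin n) : val A (m := m) (vr i) xs = xs i := rfl

@[simp] theorem val_num (i : ℕ) : val A (m := m) (num i) xs = A.numeral (min i m) := rfl

@[simp] theorem sat_imp (φ ψ : Fml m n) : Sat A (φ.imp ψ) xs ↔ (Sat A φ xs → Sat A ψ xs) := Iff.rfl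

@[simp] theorem sat_not (φ : Fml m n) : Sat A (∼φ) xs ↔ ¬ Sat A φ xs := Iff.rfl

@[simp] theorem sat_inf (φ ψ : Fml m n) : Sat A (φ ⊓ ψ) xs ↔ Sat A φ xs ∧ Sat A ψ xs :=
  letI := A.expansion (m + 1)
  BoundedFormula.realize_inf

@[simp] theorem sat_sup (φ ψ : Fml m n) : Sat A (φ ⊔ ψ) xs ↔ Sat A φ xs ∨ Sat A ψ xs :=
  letI := A.expansion (m + 1)
  BoundedFormula.realize_sup

@[simp] theorem sat_all (φ : Fml m (n + 1)) :
    Sat A (∀' φ) xs ↔ ∀ a, Sat A φ (Fin.snoc xs a) := Iff.rfl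

@[simp] theorem sat_ex (φ : Fml m (n + 1)) :
    Sat A (∃' φ) xs ↔ ∃ a, Sat A φ (Fin.snoc xs a) :=
  letI := A.expansion (m + 1)
  BoundedFormula.realize_ex

@[simp] theorem sat_bigOr (φ : ℕ → Fml m n) (N : ℕ) :
    Sat A (bigOr φ N) xs ↔ ∃ i < N, Sat A (φ i) xs :=
  letI := A.expansion (m + 1)
  realize_bigOr φ N _ _

@[simp] theorem sat_bigAnd (φ : ℕ → Fml m n) (N : ℕ) :
    Sat A (bigAnd φ N) xs ↔ ∀ i < N, Sat A (φ i) xs :=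
  letI := A.expansion (m + 1)
  realize_bigAnd φ N _ _

theorem sat_alls (φ : Fml m n) : Sat A φ.alls ![] ↔ ∀ xs, Sat A φ xs := by
  let := A.expansion (m + 1)
  rw [← models_iff_sat]
  exact BoundedFormula.realize_alls

@[simp] theorem sat_eqF (a b : Tm m n) : Sat A (eqF a b) xs ↔ val A a xs = val A b xs := Iff.rfl

@[simp] theorem sat_edgeF (a : Tm m n) : Sat A (edgeF a) xs ↔ A.IsEdge (val A a xs) :=
  letI := A.expansion (m + 1)
  BoundedFormula.realize_rel₁

@[simp] theorem sat_incF (a b : Tm m n) :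
    Sat A (incF a b) xs ↔ A.Inc (val A a xs) (val A b xs) :=
  letI := A.expansion (m + 1)
  BoundedFormula.realize_rel₂

@[simp] theorem sat_ltF (a b : Tm m n) :
    Sat A (ltF a b) xs ↔ (A.pos (val A a xs) : ℕ) < A.pos (val A b xs) :=
  letI := A.expansion (m + 1)
  Iff.trans BoundedFormula.realize_rel₂ (A.lt_iff _ _)

@[simp] theorem sat_addF (a b c : Tm m n) :
    Sat A (addF a b c) xs ↔
      (A.pos (val A c xs) : ℕ) = A.pos (val A a xs) + A.pos (val A b xs) := by
  let := A.expansion (m + 1)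
  refine Iff.trans BoundedFormula.realize_rel (Iff.trans (iff_of_eq ?_) (A.add_iff _ _ _))
  refine congrArg (Structure.RelMap (L := withArith hyper) (addSym hyper)) ?_
  ext i
  fin_cases i <;> rfl

@[simp] theorem sat_mulF (a b c : Tm m n) :
    Sat A (mulF a b c) xs ↔
      (A.pos (val A c xs) : ℕ) = A.pos (val A a xs) * A.pos (val A b xs) := by
  let := A.expansion (m + 1)
  refine Iff.trans BoundedFormula.realize_rel (Iff.trans (iff_of_eq ?_) (A.mul_iff _ _ _))
  refine congrArg (Structure.RelMap (L := withArith hyper) (mulSym hyper)) ?_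
  ext i
  fin_cases i <;> rfl

theorem pos_numeral (l : ℕ) : (A.pos (A.numeral l) : ℕ) = min l (A.size - 1) := by
  simp [ArithStructure.numeral]

theorem exists_pos_eq {a : ℕ} (ha : a < A.size) : ∃ x : A.carrier, (A.pos x : ℕ) = a :=
  ⟨A.pos.symm ⟨a, ha⟩, by simp⟩

theorem pos_inj {a b : A.carrier} : (A.pos a : ℕ) = A.pos b ↔ a = b := by
  rw [← Fin.ext_iff, A.pos.apply_eq_iff_eq]

@[simp] theorem sat_modF (x p y : Fin n) :
    Sat A (modF (m := m) x p y) xs ↔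
      0 < (A.pos (xs p) : ℕ) ∧ (A.pos (xs y) : ℕ) = A.pos (xs x) % A.pos (xs p) := by
  simp only [modF, sat_inf, sat_ex, sat_ltF, sat_mulF, sat_addF, val_vr, Fin.snoc_castSucc,
    Fin.snoc_last]
  constructor
  · rintro ⟨h₁, u, w, h₂, h₃⟩
    refine ⟨by omega, ?_⟩
    rw [h₃, h₂, Nat.mul_comm, Nat.mul_add_mod, Nat.mod_eq_of_lt h₁]
  · rintro ⟨h₁, h₂⟩
    have hd := Nat.div_add_mod (A.pos (xs x) : ℕ) (A.pos (xs p))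
    have hx := (A.pos (xs x)).isLt
    -- The quotient and its product with the modulus are at most the dividend, so both exist in the
    -- truncated arithmetic.
    obtain ⟨u, hu⟩ := exists_pos_eq (A := A) (a := (A.pos (xs x) : ℕ) / A.pos (xs p))
      ((Nat.div_le_self _ _).trans_lt hx)
    obtain ⟨w, hw⟩ := exists_pos_eq (A := A)
      (a := (A.pos (xs p) : ℕ) * (A.pos (xs x) / A.pos (xs p))) (by omega)
    refine ⟨h₂ ▸ Nat.mod_lt _ h₁, u, w, by rw [hw, hu, mul_comm], by rw [hw, h₂]; omega⟩

/-- The hypotheses keep the constants `1` and `i + 1` from being truncated. An entry whose modulus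
falls outside the universe has no value at all. -/
theorem sat_betaF {i : ℕ} (hi : i + 1 ≤ m) (hm : m < A.size) (s t y : Fin n) :
    Sat A (betaF (m := m) i s t y) xs ↔
      (i + 1) * (A.pos (xs t) : ℕ) + 1 < A.size ∧
        (A.pos (xs y) : ℕ) = A.pos (xs s) % ((i + 1) * (A.pos (xs t) : ℕ) + 1) := by
  have h₁ : min (min 1 m) (A.size - 1) = 1 := by omega
  have h₂ : min (min (i + 1) m) (A.size - 1) = i + 1 := by omega
  simp only [betaF, sat_inf, sat_ex, sat_mulF, sat_addF, sat_modF, val_vr, val_num, pos_numeral,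
    Fin.snoc_castSucc, Fin.snoc_last, h₁, h₂]
  constructor
  · rintro ⟨a, b, ⟨ha, hb⟩, -, hy⟩
    have := (A.pos b).isLt
    rw [← ha, ← hb]
    exact ⟨this, hy⟩
  · rintro ⟨hlt, hy⟩
    obtain ⟨a, ha⟩ := exists_pos_eq (A := A) (a := (i + 1) * (A.pos (xs t) : ℕ)) (by omega)
    obtain ⟨b, hb⟩ := exists_pos_eq (A := A) hlt
    exact ⟨a, b, ⟨ha, by rw [hb, ha]⟩, by omega, by rw [hb]; exact hy⟩

theorem snoc_zero {T : Type} (x : Fin 0 → T) (a : T) : (Fin.snoc x a : Fin 1 → T) = ![a] := by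
  ext i; fin_cases i; rfl

theorem snoc_one {T : Type} (a b : T) : (Fin.snoc ![a] b : Fin 2 → T) = ![a, b] := by
  ext i; fin_cases i <;> rfl

theorem snoc_two {T : Type} (a b c : T) : (Fin.snoc ![a, b] c : Fin 3 → T) = ![a, b, c] := by
  ext i; fin_cases i <;> rfl

theorem snoc_three {T : Type} (a b c e : T) :
    (Fin.snoc ![a, b, c] e : Fin 4 → T) = ![a, b, c, e] := by
  ext i; fin_cases i <;> rfl

theorem snoc_four {T : Type} (a b c e f : T) :
    (Fin.snoc ![a, b, c, e] f : Fin 5 → T) = ![a, b, c, e, f] := by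
  ext i; fin_cases i <;> rfl

theorem snoc_five {T : Type} (a b c e f g : T) :
    (Fin.snoc ![a, b, c, e, f] g : Fin 6 → T) = ![a, b, c, e, f, g] := by
  ext i; fin_cases i <;> rfl

end semantics

/-! ### The sentences -/

/-- The `i`-th digit of `x` in base `b`. -/
def dig (b x i : ℕ) : ℕ := x / b ^ i % b

section sentences

variable (m : ℕ)

/-- No vertex set has more than `d` elements. -/
def boundedF (d : ℕ) : Fml m 0 :=
  BoundedFormula.alls (n := d + 2)
    -- Variable `0` is the hyperedge, variables `1, …, d + 1` its supposed elements; the indices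
    -- stay below `d + 2`, so `Fin.ofNat` does not wrap.
    ((bigAnd (fun i => incF (vr (Fin.ofNat (d + 2) (i + 1))) (vr 0)) (d + 1)).imp
      (bigOr (fun i => bigOr (fun j => eqF (vr (Fin.ofNat (d + 2) (i + 1)))
        (vr (Fin.ofNat (d + 2) (j + 1)))) i) (d + 1)))

/-- The structure is the incidence structure of a hypergraph with hyperedges of size at most `d`. -/
def incidenceF (d : ℕ) : Fml m 0 :=
  ((∀' ∀' ((incF (vr 0) (vr 1)).imp (∼(edgeF (vr 0)) ⊓ edgeF (vr 1)))) ⊓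
    (∀' ((edgeF (vr 0)).imp (∃' (incF (vr 1) (vr 0)))))) ⊓
  ((∀' ∀' ((edgeF (vr 0)).imp ((edgeF (vr 1)).imp
    ((∀' ((incF (vr 2) (vr 0)).imp (incF (vr 2) (vr 1)) ⊓
      (incF (vr 2) (vr 1)).imp (incF (vr 2) (vr 0)))).imp (eqF (vr 0) (vr 1)))))) ⊓ boundedF m d)

/-- Some `k` of the constants form a hitting set. -/
def constantsHitF (k : ℕ) : Fml m 0 :=
  bigOr (fun x =>
    (bigAnd (fun i => bigAnd (fun j =>
        ∼(eqF (num (dig (m + 1) x i)) (num (dig (m + 1) x j)))) i) k ⊓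
      bigAnd (fun i => ∼(edgeF (num (dig (m + 1) x i)))) k) ⊓
    ∀' ((edgeF (vr 0)).imp (bigOr (fun i => incF (num (dig (m + 1) x i)) (vr 0)) k)))
    ((m + 1) ^ k)

/-- There is a coded family of `N` hyperedges without a hitting set of size `k`. -/
def obstructionF (d k N : ℕ) : Fml m 0 :=
  ∃' ∃' ∃' (
    -- Variables `0`, `1`, `2` are `p`, `s`, `t`; here `3`, `4`, `5` are a hyperedge, one of its
    -- elements and its residue. Entry `i * d + c` is place `c` of row `i`.
    bigAnd (fun i => ∃' (edgeF (vr 3) ⊓ ∀' ((incF (vr 4) (vr 3)).imp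
      (∃' (modF 4 0 5 ⊓ bigOr (fun c => betaF (i * d + c) 1 2 5) d))))) N ⊓
    -- The digits of `x` choose `k` entries; some row shares no value with them.
    bigAnd (fun x => bigOr (fun i => bigAnd (fun c => bigAnd (fun j =>
      ∼(∃' (betaF (i * d + c) 1 2 3 ⊓ betaF (dig (N * d) x j) 1 2 3))) k) d) N) ((N * d) ^ k))

/-- The number of hyperedges of an obstruction to hitting sets of size `k`. -/
def obstructionSize (d k : ℕ) : ℕ := (d + 1) ^ (k + 1)

/-- The sentence that defines the slice `k` of the problem. -/
def hittingSetF (d k : ℕ) : Fml m 0 :=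
  incidenceF m d ⊓ (constantsHitF m k ⊔
    -- The last two constants differ exactly when the universe has more than `m` elements (for
    -- positive `m`).
    (∼(eqF (num (m - 1)) (num m)) ⊓ ∼(obstructionF m d k (obstructionSize d k))))

/-! ### Quantifier ranks of the sentences -/

theorem qr_edgeF {n : ℕ} (a : Tm m n) : qr (edgeF a) = 0 := rfl

theorem qr_incF {n : ℕ} (a b : Tm m n) : qr (incF a b) = 0 := rfl

theorem qr_modF {n : ℕ} (x p y : Fin n) : qr (modF (m := m) x p y) = 2 := by
  simp only [modF, qr_inf, qr_ex]; rfl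

theorem qr_betaF {n : ℕ} (i : ℕ) (s t y : Fin n) : qr (betaF (m := m) i s t y) = 4 := by
  simp only [betaF, qr_inf, qr_ex, qr_modF]; rfl

theorem qr_all {n : ℕ} (φ : Fml m (n + 1)) : qr (∀' φ) = 1 + qr φ := rfl

theorem qr_imp {n : ℕ} (φ ψ : Fml m n) : qr (φ.imp ψ) = max (qr φ) (qr ψ) := rfl

theorem qr_boundedF_le (d : ℕ) : qr (boundedF m d) ≤ d + 2 := by
  rw [boundedF, qr_alls, qr_imp, add_le_iff_nonpos_right]
  exact max_le (qr_bigAnd_le _ fun _ => le_rfl)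
    (qr_bigOr_le _ fun _ => qr_bigOr_le _ fun _ => le_rfl)

theorem qr_incidenceF_le (d : ℕ) : qr (incidenceF m d) ≤ d + 3 := by
  have h := qr_boundedF_le m d
  simp only [incidenceF, qr_inf, qr_all, qr_imp, qr_ex, qr_not]
  simp only [edgeF, incF, eqF, qr]
  omega

theorem qr_constantsHitF_le (k : ℕ) : qr (constantsHitF m k) ≤ 1 := by
  refine qr_bigOr_le _ fun x => ?_
  rw [qr_inf, qr_inf, qr_all, qr_imp]
  refine max_le (max_le (qr_bigAnd_le _ fun _ => qr_bigAnd_le _ fun _ => ?_)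
    (qr_bigAnd_le _ fun _ => ?_)) ?_
  · exact Nat.zero_le _
  · exact Nat.zero_le _
  · have := qr_bigOr_le (q := 0) (φ := fun i => incF (m := m) (num (dig (m + 1) x i)) (vr (n := 1) 0))
      k fun _ => le_rfl
    simp only [edgeF, qr]
    omega

/-- Three quantifiers for `p`, `s`, `t`, three for hyperedge, element and residue, four inside
`betaF`. -/
theorem qr_obstructionF_le (d k N : ℕ) : qr (obstructionF m d k N) ≤ 10 := by
  simp only [obstructionF, qr_ex, qr_inf]
  have h₁ := qr_bigAnd_le (q := 7) N (φ := fun i => ∃' (edgeF (m := m) (vr 3) ⊓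
      ∀' ((incF (vr 4) (vr 3)).imp
        (∃' (modF 4 0 5 ⊓ bigOr (fun c => betaF (i * d + c) 1 2 5) d))))) fun i => by
    have := qr_bigOr_le (q := 4) (φ := fun c => betaF (m := m) (n := 6) (i * d + c) 1 2 5) d
      fun _ => (qr_betaF m _ _ _ _).le
    simp only [qr_ex, qr_inf, qr_all, qr_imp, qr_modF]
    rw [qr_edgeF, qr_incF]
    omega
  have h₂ := qr_bigAnd_le (q := 7) ((N * d) ^ k) (φ := fun x => bigOr (fun i =>
      bigAnd (fun c => bigAnd (fun j => ∼(∃' (betaF (m := m) (n := 4) (i * d + c) 1 2 3 ⊓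
        betaF (dig (N * d) x j) 1 2 3))) k) d) N) fun x =>
    qr_bigOr_le _ fun i => qr_bigAnd_le _ fun c => qr_bigAnd_le _ fun j => by
      simp [qr_not, qr_ex, qr_inf, qr_betaF]
  omega

theorem qr_hittingSetF_le (d k : ℕ) : qr (hittingSetF m d k) ≤ d + 10 := by
  have h₁ := qr_incidenceF_le m d
  have h₂ := qr_constantsHitF_le m k
  have h₃ := qr_obstructionF_le m d k (obstructionSize d k)
  simp only [hittingSetF, qr_inf, qr_sup, qr_not]
  simp only [eqF, qr]
  omega

end sentences

/-! ### Computability of the sentences -/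

theorem primrec₂_pow : Primrec₂ ((· ^ ·) : ℕ → ℕ → ℕ) :=
  (Primrec.nat_rec (f := fun _ : ℕ => 1) (g := fun (b : ℕ) (p : ℕ × ℕ) => p.2 * b)
    (Primrec.const 1)
    (Primrec.nat_mul.comp (Primrec.snd.comp Primrec.snd) Primrec.fst)).of_eq fun b i => by
      induction i with
      | zero => simp
      | succ i ih => simp only at ih ⊢; rw [ih, pow_succ]

section comp

variable {α : Type} [Primcodable α]

theorem comp_add {f g : α → ℕ} (hf : Computable f) (hg : Computable g) :
    Computable fun a => f a + g a :=
  Primrec.nat_add.to_comp.comp hf hg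

theorem comp_mul {f g : α → ℕ} (hf : Computable f) (hg : Computable g) :
    Computable fun a => f a * g a :=
  Primrec.nat_mul.to_comp.comp hf hg

theorem comp_pow {f g : α → ℕ} (hf : Computable f) (hg : Computable g) :
    Computable fun a => f a ^ g a :=
  primrec₂_pow.to_comp.comp hf hg

theorem comp_pair {f g : α → ℕ} (hf : Computable f) (hg : Computable g) :
    Computable fun a => Nat.pair (f a) (g a) :=
  Primrec₂.natPair.to_comp.comp hf hg

theorem comp_dig {b x i : α → ℕ} (hb : Computable b) (hx : Computable x) (hi : Computable i) :
    Computable fun a => dig (b a) (x a) (i a) :=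
  Primrec.nat_mod.to_comp.comp (Primrec.nat_div.to_comp.comp hx (comp_pow hb hi)) hb

/-- A computable family of terms. -/
def CompTm {n : ℕ} {m : α → ℕ} (t : ∀ a, Tm (m a) n) : Prop :=
  Computable fun a => termCode (t a)

/-- A computable family of formulas. -/
def CompFml {n : ℕ} {m : α → ℕ} (φ : ∀ a, Fml (m a) n) : Prop :=
  Computable fun a => code (φ a)

variable {n : ℕ} {m : α → ℕ}

theorem CompTm.vr (i : Fin n) : CompTm (m := m) fun _ => vr i :=
  Computable.const (termCode (SliceFO.vr (m := 0) i))

theorem CompTm.num (hm : Computable m) {i : α → ℕ} (hi : Computable i) :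
    CompTm (n := n) (m := m) fun a => num (i a) := by
  -- Constants lie in the right summand of the vocabulary, hence the odd code; relation symbols lie
  -- in the left one and get even codes.
  have h : ∀ a, termCode (SliceFO.num (m := m a) (n := n) (i a)) =
      Nat.pair 1 (Nat.pair 0 (Nat.pair (2 * min (i a) (m a) + 1)
        (Encodable.encode ([] : List ℕ)))) := fun a => rfl
  refine Computable.of_eq ?_ fun a => (h a).symm
  refine comp_pair (.const _) (comp_pair (.const _) (comp_pair ?_ (.const _)))
  exact comp_add (comp_mul (.const _) (Primrec.nat_min.to_comp.comp hi hm)) (.const _)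

theorem CompFml.rel₁ (R : (withArith hyper).Relations 1) {s : ∀ a, Tm (m a) n} (hs : CompTm s) :
    CompFml (m := m) fun a => BoundedFormula.rel (Sum.inl R) ![s a] := by
  have h : ∀ a, code (L := withNumerals hyper (m a + 1)) (α := Empty) (n := n)
      (BoundedFormula.rel (Sum.inl R) ![s a]) =
      Nat.pair 2 (Nat.pair 1 (Nat.pair (2 * Encodable.encode R)
        (Encodable.encode [termCode (s a)]))) := fun a => rfl
  refine Computable.of_eq ?_ fun a => (h a).symm
  refine comp_pair (.const _) (comp_pair (.const _) (comp_pair (.const _) ?_))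
  exact Computable.encode.comp (Computable.list_cons.comp hs (.const _))

theorem CompFml.rel₂ (R : (withArith hyper).Relations 2) {s t : ∀ a, Tm (m a) n}
    (hs : CompTm s) (ht : CompTm t) :
    CompFml (m := m) fun a => BoundedFormula.rel (Sum.inl R) ![s a, t a] := by
  have h : ∀ a, code (L := withNumerals hyper (m a + 1)) (α := Empty) (n := n)
      (BoundedFormula.rel (Sum.inl R) ![s a, t a]) =
      Nat.pair 2 (Nat.pair 2 (Nat.pair (2 * Encodable.encode R)
        (Encodable.encode [termCode (s a), termCode (t a)]))) := fun a => rfl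
  refine Computable.of_eq ?_ fun a => (h a).symm
  refine comp_pair (.const _) (comp_pair (.const _) (comp_pair (.const _) ?_))
  exact Computable.encode.comp (Computable.list_cons.comp hs
    (Computable.list_cons.comp ht (.const _)))

theorem CompFml.rel₃ (R : (withArith hyper).Relations 3) {s t u : ∀ a, Tm (m a) n}
    (hs : CompTm s) (ht : CompTm t) (hu : CompTm u) :
    CompFml (m := m) fun a => BoundedFormula.rel (Sum.inl R) ![s a, t a, u a] := by
  have h : ∀ a, code (L := withNumerals hyper (m a + 1)) (α := Empty) (n := n)
      (BoundedFormula.rel (Sum.inl R) ![s a, t a, u a]) =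
      Nat.pair 2 (Nat.pair 3 (Nat.pair (2 * Encodable.encode R)
        (Encodable.encode [termCode (s a), termCode (t a), termCode (u a)]))) := fun a => rfl
  refine Computable.of_eq ?_ fun a => (h a).symm
  refine comp_pair (.const _) (comp_pair (.const _) (comp_pair (.const _) ?_))
  exact Computable.encode.comp (Computable.list_cons.comp hs
    (Computable.list_cons.comp ht (Computable.list_cons.comp hu (.const _))))

theorem CompFml.eqF {s t : ∀ a, Tm (m a) n} (hs : CompTm s) (ht : CompTm t) :
    CompFml fun a => eqF (s a) (t a) :=
  comp_pair (.const 1) (comp_pair hs ht)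

theorem CompFml.edgeF {s : ∀ a, Tm (m a) n} (hs : CompTm s) : CompFml fun a => edgeF (s a) :=
  CompFml.rel₁ _ hs

theorem CompFml.incF {s t : ∀ a, Tm (m a) n} (hs : CompTm s) (ht : CompTm t) :
    CompFml fun a => incF (s a) (t a) :=
  CompFml.rel₂ _ hs ht

theorem CompFml.falsum : CompFml (m := m) (n := n) fun _ => ⊥ :=
  Computable.const (Nat.pair 0 0)

theorem CompFml.imp {φ ψ : ∀ a, Fml (m a) n} (hφ : CompFml φ) (hψ : CompFml ψ) :
    CompFml fun a => (φ a).imp (ψ a) :=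
  comp_pair (.const 3) (comp_pair hφ hψ)

theorem CompFml.all {φ : ∀ a, Fml (m a) (n + 1)} (hφ : CompFml φ) : CompFml fun a => ∀' (φ a) :=
  comp_pair (.const 4) hφ

theorem CompFml.not {φ : ∀ a, Fml (m a) n} (hφ : CompFml φ) : CompFml fun a => ∼(φ a) :=
  hφ.imp .falsum

theorem CompFml.ex {φ : ∀ a, Fml (m a) (n + 1)} (hφ : CompFml φ) : CompFml fun a => ∃' (φ a) :=
  hφ.not.all.not

theorem CompFml.inf {φ ψ : ∀ a, Fml (m a) n} (hφ : CompFml φ) (hψ : CompFml ψ) :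
    CompFml fun a => φ a ⊓ ψ a :=
  (hφ.imp hψ.not).not

theorem CompFml.sup {φ ψ : ∀ a, Fml (m a) n} (hφ : CompFml φ) (hψ : CompFml ψ) :
    CompFml fun a => φ a ⊔ ψ a :=
  hφ.not.imp hψ

/-- Recursion on the length, carrying the code of the partial disjunction; `φ ⊔ ψ` unfolds to `∼φ`
implying `ψ`, with `∼φ` itself an implication to `⊥`. -/
theorem CompFml.bigOr {φ : ∀ a, ℕ → Fml (m a) n} {N : α → ℕ} (hN : Computable N)
    (hφ : CompFml (α := α × ℕ) (m := fun x => m x.1) fun x => φ x.1 x.2) :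
    CompFml fun a => bigOr (φ a) (N a) := by
  have hstep : Computable fun x : α × ℕ × ℕ =>
      Nat.pair 3 (Nat.pair (Nat.pair 3 (Nat.pair x.2.2 (Nat.pair 0 0)))
        (code (φ x.1 x.2.1))) :=
    comp_pair (.const _) (comp_pair (comp_pair (.const _)
      (comp_pair (Computable.snd.comp .snd) (.const _)))
      (Computable.comp hφ (Computable.pair .fst (Computable.fst.comp .snd))))
  refine (Computable.nat_rec hN (Computable.const (Nat.pair 0 0)) hstep.to₂).of_eq fun a => ?_
  dsimp only
  induction N a with
  | zero => rfl
  | succ N ih => dsimp only; rw [ih]; rfl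

theorem CompFml.bigAnd {φ : ∀ a, ℕ → Fml (m a) n} {N : α → ℕ} (hN : Computable N)
    (hφ : CompFml (α := α × ℕ) (m := fun x => m x.1) fun x => φ x.1 x.2) :
    CompFml fun a => bigAnd (φ a) (N a) := by
  have hstep : Computable fun x : α × ℕ × ℕ =>
      Nat.pair 3 (Nat.pair (Nat.pair 3 (Nat.pair x.2.2 (Nat.pair 3 (Nat.pair
        (code (φ x.1 x.2.1)) (Nat.pair 0 0))))) (Nat.pair 0 0)) :=
    comp_pair (.const _) (comp_pair (comp_pair (.const _)
      (comp_pair (Computable.snd.comp .snd) (comp_pair (.const _) (comp_pair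
      (Computable.comp hφ (Computable.pair .fst (Computable.fst.comp .snd))) (.const _)))))
      (.const _))
  refine (Computable.nat_rec hN
    (Computable.const (Nat.pair 3 (Nat.pair (Nat.pair 0 0) (Nat.pair 0 0)))) hstep.to₂).of_eq
    fun a => ?_
  dsimp only
  induction N a with
  | zero => rfl
  | succ N ih => dsimp only; rw [ih]; rfl

theorem CompFml.alls {φ : ∀ a, Fml (m a) n} (hφ : CompFml φ) : CompFml fun a => (φ a).alls := by
  induction n with
  | zero => exact hφ
  | succ n ih => exact ih hφ.all

theorem CompFml.modF (x p y : Fin n) : CompFml (m := m) fun _ => modF x p y :=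
  (CompFml.rel₂ _ (.vr _) (.vr _)).inf
    ((CompFml.rel₃ _ (.vr _) (.vr _) (.vr _)).inf
      (CompFml.rel₃ _ (.vr _) (.vr _) (.vr _))).ex.ex

theorem CompFml.betaF (hm : Computable m) {i : α → ℕ} (hi : Computable i) (s t y : Fin n) :
    CompFml (m := m) fun a => betaF (i a) s t y :=
  (((CompFml.rel₃ _ (.num hm (comp_add hi (.const 1))) (.vr _) (.vr _)).inf
    (CompFml.rel₃ _ (.vr _) (.num hm (.const 1)) (.vr _))).inf (.modF _ _ _)).ex.ex

theorem CompFml.incidenceF (d : ℕ) : CompFml fun a => incidenceF (m a) d := by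
  refine (((CompFml.all (.all (.imp (.incF (.vr _) (.vr _))
    (.inf (.not (.edgeF (.vr _))) (.edgeF (.vr _)))))).inf
    (.all (.imp (.edgeF (.vr _)) (.ex (.incF (.vr _) (.vr _)))))).inf
    (.inf (.all (.all (.imp (.edgeF (.vr _)) (.imp (.edgeF (.vr _)) (.imp (.all (.inf
      (.imp (.incF (.vr _) (.vr _)) (.incF (.vr _) (.vr _)))
      (.imp (.incF (.vr _) (.vr _)) (.incF (.vr _) (.vr _))))) (.eqF (.vr _) (.vr _))))))) ?_))
  have hvr : Computable fun i : ℕ => termCode (SliceFO.vr (m := 0) (Fin.ofNat (d + 2) (i + 1))) :=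
    comp_pair (.const 0) (comp_add (comp_mul (.const 2) (Primrec.nat_mod.to_comp.comp
      (comp_add .id (.const 1)) (.const (d + 2)))) (.const 1))
  refine CompFml.alls (.imp (.bigAnd (.const _) (.incF ?_ (.vr _)))
    (.bigOr (.const _) (.bigOr .snd (.eqF ?_ ?_))))
  · exact hvr.comp Computable.snd
  · exact hvr.comp (Computable.snd.comp Computable.fst)
  · exact hvr.comp Computable.snd

theorem CompFml.constantsHitF (hm : Computable m) {k : α → ℕ} (hk : Computable k) :
    CompFml fun a => constantsHitF (m a) (k a) := by
  have hb : Computable fun a => m a + 1 := comp_add hm (.const 1)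
  have hb1 : Computable fun x : α × ℕ => m x.1 + 1 := hb.comp .fst
  have hb2 : Computable fun x : (α × ℕ) × ℕ => m x.1.1 + 1 := hb1.comp .fst
  have hb3 : Computable fun x : ((α × ℕ) × ℕ) × ℕ => m x.1.1.1 + 1 := hb2.comp .fst
  have hd2 : CompTm (α := (α × ℕ) × ℕ) (m := fun x => m x.1.1) (n := 0) fun x =>
      SliceFO.num (dig (m x.1.1 + 1) x.1.2 x.2) :=
    .num (hm.comp (Computable.fst.comp .fst)) (comp_dig hb2 (Computable.snd.comp .fst) .snd)
  have hd2' : CompTm (α := (α × ℕ) × ℕ) (m := fun x => m x.1.1) (n := 1) fun x =>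
      SliceFO.num (dig (m x.1.1 + 1) x.1.2 x.2) :=
    .num (hm.comp (Computable.fst.comp .fst)) (comp_dig hb2 (Computable.snd.comp .fst) .snd)
  have hm3 : Computable fun x : ((α × ℕ) × ℕ) × ℕ => m x.1.1.1 :=
    hm.comp (Computable.fst.comp (Computable.fst.comp .fst))
  have hx3 : Computable fun x : ((α × ℕ) × ℕ) × ℕ => x.1.1.2 :=
    Computable.snd.comp (Computable.fst.comp .fst)
  have hk1 : Computable fun x : α × ℕ => k x.1 := hk.comp .fst
  exact .bigOr (comp_pow hb hk) (.inf (.inf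
    (.bigAnd hk1 (.bigAnd .snd (.not (.eqF
      (.num hm3 (comp_dig hb3 hx3 (Computable.snd.comp .fst)))
      (.num hm3 (comp_dig hb3 hx3 .snd))))))
    (.bigAnd hk1 (.not (.edgeF hd2))))
    (.all (.imp (.edgeF (.vr _)) (.bigOr hk1 (.incF hd2' (.vr _))))))

theorem CompFml.obstructionF (hm : Computable m) (d : ℕ) {k N : α → ℕ} (hk : Computable k)
    (hN : Computable N) : CompFml fun a => obstructionF (m a) d (k a) (N a) := by
  have h2 : Computable fun x : (α × ℕ) × ℕ => x.1.1 := Computable.fst.comp .fst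
  have h4 : Computable fun x : (((α × ℕ) × ℕ) × ℕ) × ℕ => x.1.1 := Computable.fst.comp .fst
  have hNd : Computable fun a => N a * d := comp_mul hN (.const d)
  refine .ex (.ex (.ex (.inf
    (.bigAnd hN (.ex (.inf (.edgeF (.vr _)) (.all (.imp (.incF (.vr _) (.vr _)) (.ex (.inf
      (.modF _ _ _) (.bigOr (.const d) (.betaF (hm.comp h2)
        (comp_add (comp_mul (Computable.snd.comp .fst) (.const d)) .snd) _ _ _)))))))))
    (.bigAnd (comp_pow hNd hk) (.bigOr (hN.comp .fst) (.bigAnd (.const d)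
      (.bigAnd (hk.comp (h2.comp .fst)) (.not (.ex (.inf
        (.betaF (hm.comp (h2.comp h4))
          (comp_add (comp_mul (Computable.snd.comp h4) (.const d)) (Computable.snd.comp .fst))
          _ _ _)
        (.betaF (hm.comp (h2.comp h4))
          (comp_dig (hNd.comp (h2.comp h4))
            (Computable.snd.comp (Computable.fst.comp h4)) .snd) _ _ _)))))))))))

theorem CompFml.hittingSetF (hm : Computable m) (d : ℕ) {k : α → ℕ} (hk : Computable k) :
    CompFml fun a => hittingSetF (m a) d (k a) :=
  .inf (.incidenceF d) (.sup (.constantsHitF hm hk) (.inf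
    (.not (.eqF (.num hm (Primrec.nat_sub.to_comp.comp hm (.const 1))) (.num hm hm)))
    (.not (.obstructionF hm d hk (comp_pow (.const _) (comp_add hk (.const 1)))))))

end comp

/-- The number of constants used for the slice `k`, apart from `0`. -/
def numConstants (d k : ℕ) : ℕ :=
  -- The summands serve the β-code, the enlargement of hitting sets (`k + 2 ^ k`) and the constants
  -- indexing the entries.
  codingBound (obstructionSize d k * d) + k + 2 ^ k + obstructionSize d k * d + 2

theorem computable_numConstants (d : ℕ) : Computable (numConstants d) := by
  have hM : Computable fun k => obstructionSize d k * d :=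
    comp_mul (comp_pow (.const _) (comp_add .id (.const 1))) (.const d)
  refine comp_add (comp_add (comp_add (comp_add ?_ .id) (comp_pow (.const 2) .id)) hM) (.const 2)
  exact comp_pow (.const 2) (comp_mul (comp_mul (.const 4) (comp_pow hM (.const 2)))
    (comp_mul (comp_mul (.const 4) (comp_pow hM (.const 3))) (comp_pow hM hM)))

/-! ### Correctness of the sentences -/

/-- Lets one number run through all `k`-tuples, so that conjunctions and disjunctions over tuples
become `bigAnd` and `bigOr`. -/
theorem exists_dig {M k : ℕ} (g : Fin k → Fin M) :
    ∃ x < M ^ k, ∀ j : Fin k, dig M x j = g j := by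
  refine ⟨finFunctionFinEquiv g, (finFunctionFinEquiv g).isLt, fun j => ?_⟩
  conv_rhs => rw [← finFunctionFinEquiv.symm_apply_apply g]
  rfl

theorem exists_fin_range_of_encard_eq {T : Type} {S : Set T} {k : ℕ} (hS : S.encard = k) :
    ∃ f : Fin k → T, Function.Injective f ∧ Set.range f = S := by
  have hfin : S.Finite := Set.finite_of_encard_eq_coe hS
  rw [hfin.encard_eq_coe_toFinset_card] at hS
  have hcard : hfin.toFinset.card = k := by exact_mod_cast hS
  let e := (hfin.toFinset.equivFinOfCardEq hcard).symm
  refine ⟨fun i => e i, fun i j h => e.injective (Subtype.ext h), ?_⟩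
  ext x
  constructor
  · rintro ⟨i, rfl⟩
    exact hfin.mem_toFinset.1 (e i).2
  · intro hx
    exact ⟨e.symm ⟨x, hfin.mem_toFinset.2 hx⟩, by simp⟩

/-! ### Recognizing hypergraphs -/

section incidence

variable {m d : ℕ} {A : ArithStructure hyper}

theorem sat_boundedF : Sat A (boundedF m d) ![] ↔
    ∀ e (x : Fin (d + 1) → A.carrier), (∀ i, A.Inc (x i) e) → ∃ i j, j < i ∧ x i = x j := by
  have hsucc : ∀ i (hi : i < d + 1), Fin.ofNat (d + 2) (i + 1) = Fin.succ ⟨i, hi⟩ := by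
    intro i hi
    ext
    simp [Fin.ofNat, Nat.mod_eq_of_lt (show i + 1 < d + 2 by omega)]
  rw [boundedF, sat_alls]
  simp only [sat_imp, sat_bigAnd, sat_bigOr, sat_incF, sat_eqF, val_vr]
  constructor
  · intro h e x hx
    obtain ⟨i, hi, j, hj, hij⟩ := h (Fin.cons e x) fun i hi => by
      rw [hsucc i hi, Fin.cons_succ, Fin.cons_zero]
      exact hx ⟨i, hi⟩
    rw [hsucc i hi, hsucc j (hj.trans hi), Fin.cons_succ, Fin.cons_succ] at hij
    exact ⟨_, _, hj, hij⟩
  · intro h xs hxs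
    obtain ⟨i, j, hji, hij⟩ := h (xs 0) (fun i => xs i.succ) fun i => by
      have := hxs i i.isLt
      rwa [hsucc i i.isLt] at this
    refine ⟨i, i.isLt, j, hji, ?_⟩
    rw [hsucc i i.isLt, hsucc j j.isLt]
    exact hij

theorem sat_incidenceF : Sat A (incidenceF m d) ![] ↔ IsIncidence d A.IsEdge A.Inc := by
  simp only [incidenceF, sat_inf, sat_boundedF]
  simp only [sat_inf, sat_all, sat_imp, sat_ex, sat_not, sat_incF, sat_edgeF, sat_eqF, val_vr,
    snoc_zero, snoc_one, snoc_two, Matrix.cons_val]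
  constructor
  · rintro ⟨⟨h₁, h₂⟩, h₃, h₄⟩
    exact ⟨h₁, h₂, fun e f he hf h => h₃ e f he hf fun v => ⟨(h v).1, (h v).2⟩, h₄⟩
  · rintro ⟨h₁, h₂, h₃, h₄⟩
    exact ⟨⟨h₁, h₂⟩, fun e f he hf h => h₃ e f he hf fun v => ⟨(h v).1, (h v).2⟩, h₄⟩

end incidence

/-! ### Small universes: hitting sets among the constants -/

section constants

variable {m k : ℕ} {A : ArithStructure hyper}

theorem sat_constantsHitF : Sat A (constantsHitF m k) ![] ↔
    ∃ x < (m + 1) ^ k,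
      ((∀ i < k, ∀ j < i, A.numeral (dig (m + 1) x i) ≠ A.numeral (dig (m + 1) x j)) ∧
        ∀ i < k, ¬ A.IsEdge (A.numeral (dig (m + 1) x i))) ∧
      ∀ e, A.IsEdge e → ∃ i < k, A.Inc (A.numeral (dig (m + 1) x i)) e := by
  have hmin : ∀ x i, min (dig (m + 1) x i) m = dig (m + 1) x i := fun x i =>
    min_eq_left (Nat.lt_succ_iff.1 (Nat.mod_lt _ (Nat.succ_pos m)))
  simp only [constantsHitF, sat_inf, sat_all, sat_imp, sat_not, sat_bigOr, sat_bigAnd, sat_incF,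
    sat_edgeF, sat_eqF, val_vr, val_num, snoc_zero, Matrix.cons_val, hmin, ne_eq]

/-- Sound for universes of any size: truncated constants may coincide, but the sentence asks for
distinct elements. -/
theorem exists_hits_of_sat_constantsHitF (h : Sat A (constantsHitF m k) ![]) :
    ∃ S : Set A.carrier, Hits A.IsEdge A.Inc S ∧ S.encard = k := by
  obtain ⟨x, -, ⟨h₁, h₂⟩, h₃⟩ := sat_constantsHitF.1 h
  let f : Fin k → A.carrier := fun i => A.numeral (dig (m + 1) x i)
  have hf : Function.Injective f := by
    intro i j hij
    rcases lt_trichotomy i j with h | h | h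
    · exact absurd hij.symm (h₁ j j.isLt i h)
    · exact h
    · exact absurd hij (h₁ i i.isLt j h)
  refine ⟨Set.range f, ⟨?_, fun e he => ?_⟩, ?_⟩
  · rintro _ ⟨i, rfl⟩
    exact h₂ i i.isLt
  · obtain ⟨i, hi, hie⟩ := h₃ e he
    exact ⟨_, ⟨⟨i, hi⟩, rfl⟩, hie⟩
  · rw [← Set.image_univ, hf.encard_image, Set.encard_univ]
    simp

theorem sat_constantsHitF_of_hits (hm : A.size ≤ m + 1) {S : Set A.carrier}
    (hS : Hits A.IsEdge A.Inc S) (hk : S.encard = k) : Sat A (constantsHitF m k) ![] := by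
  obtain ⟨f, hf, rfl⟩ := exists_fin_range_of_encard_eq hk
  obtain ⟨x, hx, hxd⟩ := exists_dig (M := m + 1) fun i =>
    ⟨(A.pos (f i) : ℕ), (A.pos (f i)).isLt.trans_le hm⟩
  have hnum : ∀ i (hi : i < k), A.numeral (dig (m + 1) x i) = f ⟨i, hi⟩ := by
    intro i hi
    rw [hxd ⟨i, hi⟩, ← pos_inj, pos_numeral]
    have := (A.pos (f ⟨i, hi⟩)).isLt
    simp only
    omega
  rw [sat_constantsHitF]
  refine ⟨x, hx, ⟨fun i hi j hj h => ?_, fun i hi => ?_⟩, fun e he => ?_⟩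
  · rw [hnum i hi, hnum j (hj.trans hi)] at h
    have := congrArg Fin.val (hf h)
    simp only at this
    omega
  · rw [hnum i hi]
    exact hS.1 _ ⟨_, rfl⟩
  · obtain ⟨_, ⟨i, rfl⟩, hi⟩ := hS.2 e he
    exact ⟨i, i.isLt, by rw [hnum i i.isLt]; exact hi⟩

end constants

/-! ### Large universes: coded obstructions -/

section obstruction

theorem mul_add_lt_mul {i N c d : ℕ} (hi : i < N) (hc : c < d) : i * d + c < N * d := by
  have : (i + 1) * d ≤ N * d := Nat.mul_le_mul_right _ hi
  rw [add_mul, one_mul] at this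
  omega

/-- A family of hyperedges, described by codes `B i` of the images of their elements under a map,
refutes the existence of a hitting set of size `k` if no `k` of the codes form one. -/
theorem not_hits_of_coded_obstruction {T : Type} {E : T → Prop} {I R : T → T → Prop}
    {B : ℕ → T → Prop} {d k N : ℕ} (hR : ∀ v y y', R v y → R v y' → y = y') (hNd : 0 < N * d)
    (h₁ : ∀ i < N, ∃ e, E e ∧ ∀ v, I v e → ∃ y, R v y ∧ ∃ c < d, B (i * d + c) y)
    (h₂ : ∀ x < (N * d) ^ k, ∃ i < N, ∀ c < d, ∀ j < k,
      ¬ ∃ y, B (i * d + c) y ∧ B (dig (N * d) x j) y)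
    {S : Set T} (hS : Hits E I S) (hk : S.encard = k) : False := by
  obtain ⟨f, -, rfl⟩ := exists_fin_range_of_encard_eq hk
  -- Each element of the hitting set picks an entry equal to its code, if there is one; otherwise
  -- entry `0` is a harmless default.
  have hg : ∀ j : Fin k, ∃ l : Fin (N * d),
      (∃ l' : Fin (N * d), ∃ y, R (f j) y ∧ B l' y) → ∃ y, R (f j) y ∧ B l y := by
    intro j
    by_cases h : ∃ l' : Fin (N * d), ∃ y, R (f j) y ∧ B l' y
    · obtain ⟨l, hl⟩ := h
      exact ⟨l, fun _ => hl⟩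
    · exact ⟨⟨0, hNd⟩, fun h' => absurd h' h⟩
  choose g hg using hg
  obtain ⟨x, hx, hxg⟩ := exists_dig g
  obtain ⟨i, hi, hno⟩ := h₂ x hx
  obtain ⟨e, he, hev⟩ := h₁ i hi
  obtain ⟨_, ⟨j, rfl⟩, hj⟩ := hS.2 e he
  obtain ⟨y, hy, c, hc, hB⟩ := hev _ hj
  obtain ⟨y', hy', hB'⟩ := hg j ⟨⟨i * d + c, mul_add_lt_mul hi hc⟩, y, hy, hB⟩
  obtain rfl := hR _ _ _ hy hy'
  exact hno c hc j j.isLt ⟨y, hB, by rwa [hxg j]⟩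

/-- A hypergraph without a hitting set of size at most `k` has an obstruction, given by a matrix
that lists the elements of its hyperedges. -/
theorem IsIncidence.exists_obstruction_matrix {d : ℕ} (hd : 0 < d) {T : Type} [Finite T]
    {E : T → Prop} {I : T → T → Prop} (h : IsIncidence d E I) {k : ℕ}
    (hno : ∀ S : Set T, Hits E I S → ¬ S.encard ≤ k) :
    ∃ (e : ℕ → T) (v : ℕ → T), (∀ i, E (e i)) ∧
      (∀ i u, I u (e i) ↔ ∃ c < d, u = v (i * d + c)) ∧
      ∀ S : Set T, S.encard ≤ k → ∃ i < obstructionSize d k, ∀ u ∈ S, ¬ I u (e i) := by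
  classical
  have := Fintype.ofFinite T
  let nb : T → Finset T := fun e => Finset.univ.filter fun v => I v e
  have hnb : ∀ e v, v ∈ nb e ↔ I v e := fun e v => by simp [nb]
  have hcard : ∀ e, (nb e).card ≤ d := by
    intro e
    have := h.encard_le e
    have hs : {v | I v e} = (nb e : Set T) := by ext v; simp [nb]
    rw [hs, Set.encard_coe_eq_coe_finsetCard] at this
    exact_mod_cast this
  obtain ⟨G, hGF, hGc, hG⟩ := exists_small_obstruction d k
    ((Finset.univ.filter fun e => E e).image nb)
    (by
      intro s hs
      obtain ⟨e, -, rfl⟩ := Finset.mem_image.1 hs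
      exact hcard e)
    (by
      intro H hH
      by_contra! hcon
      -- `H` may contain hyperedges; they are incident with nothing as vertices and can be dropped.
      refine hno {v | v ∈ H ∧ ¬ E v} ⟨fun v hv => hv.2, fun e he => ?_⟩ ?_
      · obtain ⟨v, hvH, hve⟩ := Finset.not_disjoint_iff.1
          (hcon (nb e) (Finset.mem_image_of_mem _ (by simpa using he)))
        exact ⟨v, ⟨hvH, (h.inc v e ((hnb e v).1 hve)).1⟩, (hnb e v).1 hve⟩
      · refine (Set.encard_le_encard (t := (H : Set T)) fun v hv => hv.1).trans ?_
        rw [Set.encard_coe_eq_coe_finsetCard]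
        exact_mod_cast hH)
  obtain ⟨s₀, hs₀, -⟩ := hG ∅ (by simp)
  -- The subfamily is nonempty, since the empty set fails to hit it, so the list can be padded with
  -- repetitions.
  have hsurj : ∃ F : ℕ → Finset T, (∀ i, F i ∈ G) ∧
      ∀ s ∈ G, ∃ i < obstructionSize d k, F i = s := by
    refine ⟨fun i => if hi : i < G.card then G.equivFin.symm ⟨i, hi⟩ else s₀, fun i => ?_,
      fun s hs => ⟨G.equivFin ⟨s, hs⟩, ?_, ?_⟩⟩
    · dsimp only
      split_ifs with hi
      · exact (G.equivFin.symm ⟨i, hi⟩).2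
      · exact hs₀
    · refine (G.equivFin ⟨s, hs⟩).isLt.trans_le (hGc.trans ?_)
      exact Nat.pow_le_pow_right (by omega) (by omega)
    · simp
  obtain ⟨F, hFG, hF⟩ := hsurj
  have hFe : ∀ i, ∃ e, E e ∧ nb e = F i := by
    intro i
    obtain ⟨e, he, hes⟩ := Finset.mem_image.1 (hGF (hFG i))
    exact ⟨e, by simpa using he, hes⟩
  choose e he heF using hFe
  -- Short rows are padded with an element of the same hyperedge, which exists because hyperedges
  -- are nonempty.
  have hrow : ∀ i, ∃ w : ℕ → T, ∀ u, I u (e i) ↔ ∃ c < d, u = w c := by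
    intro i
    obtain ⟨u₀, hu₀⟩ := h.nonempty (e i) (he i)
    let N := nb (e i)
    refine ⟨fun c => if hc : c < N.card then N.equivFin.symm ⟨c, hc⟩ else u₀, fun u => ⟨?_, ?_⟩⟩
    · intro hu
      have huN : u ∈ N := (hnb _ _).2 hu
      exact ⟨N.equivFin ⟨u, huN⟩, (N.equivFin ⟨u, huN⟩).isLt.trans_le (hcard _), by simp⟩
    · rintro ⟨c, -, rfl⟩
      dsimp only
      split_ifs with hc
      · exact (hnb _ _).1 (N.equivFin.symm ⟨c, hc⟩).2
      · exact hu₀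
  choose w hw using hrow
  refine ⟨e, fun l => w (l / d) (l % d), he, fun i u => ?_, fun S hS => ?_⟩
  · rw [hw]
    refine exists_congr fun c => and_congr_right fun hc => ?_
    dsimp only
    rw [mul_comm, Nat.mul_add_div hd, Nat.div_eq_of_lt hc, Nat.mul_add_mod, Nat.mod_eq_of_lt hc,
      add_zero]
  · have hfin := S.toFinite
    rw [hfin.encard_eq_coe_toFinset_card] at hS
    obtain ⟨s, hs, hds⟩ := hG hfin.toFinset (by exact_mod_cast hS)
    obtain ⟨i, hi, rfl⟩ := hF s hs
    refine ⟨i, hi, fun u hu hI => ?_⟩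
    refine Finset.disjoint_left.1 hds (hfin.mem_toFinset.2 hu) ?_
    rw [← heF, hnb]
    exact hI

variable {m d k N : ℕ} {A : ArithStructure hyper}

theorem sat_obstructionF (hN : N * d ≤ m) (hm : m < A.size) :
    Sat A (obstructionF m d k N) ![] ↔ ∃ p s t : A.carrier,
      let R : A.carrier → A.carrier → Prop := fun v y =>
        0 < (A.pos p : ℕ) ∧ (A.pos y : ℕ) = A.pos v % A.pos p
      let B : ℕ → A.carrier → Prop := fun i y => (i + 1) * (A.pos t : ℕ) + 1 < A.size ∧
        (A.pos y : ℕ) = A.pos s % ((i + 1) * (A.pos t : ℕ) + 1)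
      (∀ i < N, ∃ e, A.IsEdge e ∧ ∀ v, A.Inc v e → ∃ y, R v y ∧ ∃ c < d, B (i * d + c) y) ∧
      ∀ x < (N * d) ^ k, ∃ i < N, ∀ c < d, ∀ j < k,
        ¬ ∃ y, B (i * d + c) y ∧ B (dig (N * d) x j) y := by
  simp only [obstructionF, sat_ex, sat_inf, sat_bigAnd, sat_bigOr, sat_all, sat_imp, sat_not,
    sat_edgeF, sat_incF, sat_modF, val_vr, snoc_zero, snoc_one, snoc_two, snoc_three, snoc_four,
    snoc_five, Matrix.cons_val]
  refine exists_congr fun p => exists_congr fun s => exists_congr fun t => and_congr ?_ ?_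
  · refine forall_congr' fun i => forall_congr' fun hi => exists_congr fun e =>
      and_congr_right fun _ => forall_congr' fun v => forall_congr' fun _ => exists_congr fun y =>
      and_congr_right fun _ => exists_congr fun c => and_congr_right fun hc => ?_
    have := mul_add_lt_mul hi hc
    exact sat_betaF (by omega) hm _ _ _
  · refine forall_congr' fun x => forall_congr' fun _ => exists_congr fun i =>
      and_congr_right fun hi => forall_congr' fun c => forall_congr' fun hc =>
      forall_congr' fun j => forall_congr' fun _ => not_congr (exists_congr fun y => ?_)
    have h₁ := mul_add_lt_mul hi hc
    have h₂ : dig (N * d) x j < N * d := Nat.mod_lt _ (by omega)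
    exact and_congr (sat_betaF (by omega) hm _ _ _) (sat_betaF (by omega) hm _ _ _)

theorem not_sat_obstructionF_of_hits (hNd : 0 < N * d) (hN : N * d ≤ m) (hm : m < A.size)
    {S : Set A.carrier} (hS : Hits A.IsEdge A.Inc S) (hk : S.encard = k) :
    ¬ Sat A (obstructionF m d k N) ![] := by
  rw [sat_obstructionF hN hm]
  rintro ⟨p, s, t, h₁, h₂⟩
  refine not_hits_of_coded_obstruction
    (R := fun v y => 0 < (A.pos p : ℕ) ∧ (A.pos y : ℕ) = A.pos v % A.pos p)
    (B := fun i y => (i + 1) * (A.pos t : ℕ) + 1 < A.size ∧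
      (A.pos y : ℕ) = A.pos s % ((i + 1) * (A.pos t : ℕ) + 1))
    (fun v y y' hy hy' => ?_) hNd h₁ h₂ hS hk
  exact pos_inj.1 (hy.2.trans hy'.2.symm)

instance (A : ArithStructure hyper) : Finite A.carrier := Finite.of_equiv _ A.pos.symm

theorem sat_obstructionF_of_no_hits (hd : 0 < d) (hN : obstructionSize d k * d ≤ m)
    (hc : codingBound (obstructionSize d k * d) ≤ m) (hm : m < A.size)
    (hA : IsIncidence d A.IsEdge A.Inc)
    (hno : ∀ S : Set A.carrier, Hits A.IsEdge A.Inc S → ¬ S.encard ≤ k) :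
    Sat A (obstructionF m d k (obstructionSize d k)) ![] := by
  obtain ⟨e, v, he, hev, hS⟩ := hA.exists_obstruction_matrix hd hno
  -- The exponent `k + 1` in `obstructionSize` ensures this even for `k = 0` and `d = 1`.
  have hM : 2 ≤ obstructionSize d k * d := by
    have h₁ : (d + 1) ^ 1 ≤ (d + 1) ^ (k + 1) := Nat.pow_le_pow_right (by omega) (by omega)
    have h₂ : 2 ≤ obstructionSize d k := by
      rw [pow_one] at h₁
      unfold obstructionSize
      omega
    exact h₂.trans (Nat.le_mul_of_pos_right _ hd)
  obtain ⟨p, s, t, hp0, hp, hs, ht, hMt, hcode, hinj⟩ := exists_hash_code hM (hc.trans hm.le)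
    (fun i => (A.pos (v i) : ℕ)) fun i => (A.pos (v i)).isLt
  obtain ⟨p, rfl⟩ := exists_pos_eq hp
  obtain ⟨s, rfl⟩ := exists_pos_eq hs
  obtain ⟨t, rfl⟩ := exists_pos_eq ht
  rw [sat_obstructionF hN hm]
  refine ⟨p, s, t, fun i hi => ⟨e i, he i, fun u hu => ?_⟩, fun x _ => ?_⟩
  · obtain ⟨c, hc, rfl⟩ := (hev i u).1 hu
    have hl := mul_add_lt_mul hi hc
    obtain ⟨y, hy⟩ := exists_pos_eq (A := A) (a := (A.pos (v (i * d + c)) : ℕ) % A.pos p)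
      ((Nat.mod_le _ _).trans_lt (A.pos _).isLt)
    refine ⟨y, ⟨hp0, hy⟩, c, hc, ?_, ?_⟩
    · have : (i * d + c + 1) * (A.pos t : ℕ) ≤ obstructionSize d k * d * A.pos t :=
        Nat.mul_le_mul_right _ hl
      omega
    · rw [hy]
      exact (hcode ⟨_, hl⟩).symm
  -- The chosen entries stand for at most `k` actual vertices, which miss some row; a common residue
  -- would force a common vertex, since `p` separates the listed ones.
  · obtain ⟨i, hi, hSi⟩ := hS (Set.range fun j : Fin k => v (dig (obstructionSize d k * d) x j)) (by
      rw [← Set.image_univ]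
      refine (Set.encard_image_le _ _).trans ?_
      simp)
    refine ⟨i, hi, fun c hc j hj => ?_⟩
    rintro ⟨y, ⟨-, hy⟩, -, hy'⟩
    have hl := mul_add_lt_mul hi hc
    have hl' : dig (obstructionSize d k * d) x j < obstructionSize d k * d :=
      Nat.mod_lt _ (by omega)
    have h₁ := hcode ⟨_, hl⟩
    have h₂ := hcode ⟨_, hl'⟩
    simp only at h₁ h₂
    rw [← hy] at h₁
    rw [← hy'] at h₂
    have hne : v (i * d + c) ≠ v (dig (obstructionSize d k * d) x j) := by
      intro heq
      exact hSi _ ⟨⟨j, hj⟩, heq.symm⟩ ((hev i _).2 ⟨c, hc, rfl⟩)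
    exact hinj ⟨_, hl⟩ ⟨_, hl'⟩ (fun h => hne (pos_inj.1 h)) (h₁.symm.trans h₂)

end obstruction

/-- In a large hypergraph, small hitting sets can be enlarged to size `k`. -/
theorem IsIncidence.exists_hits_encard_eq {d k : ℕ} {T : Type} [Finite T] {E : T → Prop}
    {I : T → T → Prop} (h : IsIncidence d E I) (hT : k + 2 ^ k < Nat.card T) {S : Set T}
    (hS : Hits E I S) (hk : S.encard ≤ k) : ∃ S' : Set T, Hits E I S' ∧ S'.encard = k := by
  classical
  have := Fintype.ofFinite T
  -- With fewer than `k` vertices, extensionality would allow at most `2 ^ k` hyperedges, too few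
  -- for the universe.
  have hV : (k : ℕ∞) ≤ {v | ¬ E v}.encard := by
    by_contra! hlt
    let V : Finset T := Finset.univ.filter fun v => ¬ E v
    have hVc : V.card < k := by
      have hs : {v | ¬ E v} = (V : Set T) := by ext v; simp [V]
      rw [hs, Set.encard_coe_eq_coe_finsetCard] at hlt
      exact_mod_cast hlt
    have hEc : (Finset.univ.filter fun e => E e).card ≤ V.powerset.card := by
      refine Finset.card_le_card_of_injOn (fun e => V.filter fun v => I v e) ?_ ?_
      · intro e _
        simp only [Finset.coe_powerset, Set.mem_preimage, Set.mem_powerset_iff, Finset.coe_subset]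
        exact Finset.filter_subset _ _
      · intro e he f hf hef
        have he' : E e := by simpa using he
        have hf' : E f := by simpa using hf
        refine h.ext e f he' hf' fun v => ?_
        have := Finset.ext_iff.1 hef v
        simp only [V, Finset.mem_filter, Finset.mem_univ, true_and] at this
        exact ⟨fun hv => (this.1 ⟨(h.inc v e hv).1, hv⟩).2,
          fun hv => (this.2 ⟨(h.inc v f hv).1, hv⟩).2⟩
    rw [Finset.card_powerset] at hEc
    have hsum := Finset.card_filter_add_card_filter_not (s := (Finset.univ : Finset T)) E
    rw [Finset.card_univ, ← Nat.card_eq_fintype_card] at hsum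
    have h2 : 2 ^ V.card ≤ 2 ^ k := Nat.pow_le_pow_right (by norm_num) hVc.le
    have hsum' : (Finset.univ.filter fun e => E e).card + V.card = Nat.card T := hsum
    omega
  obtain ⟨S', hSS', hS'V, hS'⟩ := Set.exists_superset_subset_encard_eq
    (show S ⊆ {v | ¬ E v} from hS.1) hk hV
  exact ⟨S', ⟨hS'V, fun e he => (hS.2 e he).imp fun v hv => ⟨hSS' hv.1, hv.2⟩⟩, hS'⟩

theorem yes_iff_models {d : ℕ} (hd : 1 ≤ d) (A : ArithStructure hyper) (k : ℕ) :
    (pHittingSet d).Yes A k ↔ A.Models (hittingSetF (numConstants d k) d k) := by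
  set m := numConstants d k with hm
  have hm' : m = codingBound (obstructionSize d k * d) + k + 2 ^ k + obstructionSize d k * d + 2 :=
    rfl
  have h2k : 0 < 2 ^ k := Nat.two_pow_pos k
  have hlarge : A.numeral (min (m - 1) m) ≠ A.numeral (min m m) ↔ m < A.size := by
    rw [ne_eq, ← pos_inj, pos_numeral, pos_numeral]
    have := A.size_pos
    omega
  have hNd : 0 < obstructionSize d k * d := by unfold obstructionSize; positivity
  rw [pHittingSet_yes_iff, models_iff_sat, hittingSetF]
  simp only [sat_inf, sat_sup, sat_not, sat_incidenceF, sat_eqF, val_num]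
  rw [← ne_eq, hlarge]
  refine and_congr_right fun hA => ⟨?_, ?_⟩
  · rintro ⟨S, hS, hk⟩
    rcases Nat.lt_or_ge m A.size with h | h
    · exact Or.inr ⟨h, not_sat_obstructionF_of_hits hNd (by omega) h hS hk⟩
    · exact Or.inl (sat_constantsHitF_of_hits (by omega) hS hk)
  · rintro (h | ⟨h, hobs⟩)
    · exact exists_hits_of_sat_constantsHitF h
    · by_contra hno
      -- An obstruction requires that no hitting set has size at most `k`, whereas `hno` excludes
      -- size exactly `k`; enlargement closes the gap.
      refine hobs (sat_obstructionF_of_no_hits hd (by omega) (by omega) h hA fun S hS hk => ?_)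
      refine hno (hA.exists_hits_encard_eq ?_ hS hk)
      rw [Nat.card_congr A.pos, Nat.card_fin]
      omega

end SliceFO

theorem mainTheorem5 :
    ∃ C : ℕ, ∀ d : ℕ, 1 ≤ d →
      ∃ q : ℕ, q ≤ C * d ^ 2 ∧ SliceFO.SlicewiseDefinable (SliceFO.pHittingSet d) q := by
  -- The constants are `0, …, m`, hence one more than `numConstants`; and `d + 10 ≤ 11 * d ^ 2` for
  -- `d ≥ 1`.
  refine ⟨11, fun d hd => ⟨d + 10, by nlinarith, fun k => SliceFO.numConstants d k + 1,
    fun k => SliceFO.hittingSetF (SliceFO.numConstants d k) d k, ?_, ?_, fun k => ?_, ?_⟩⟩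
  · exact SliceFO.comp_add (SliceFO.computable_numConstants d) (.const 1)
  · exact SliceFO.CompFml.hittingSetF (SliceFO.computable_numConstants d) d .id
  · exact SliceFO.qr_hittingSetF_le _ d k
  · exact SliceFO.yes_iff_models hd
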